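/- Let $0 < n_1 < \dots < n_d < n$ be integers. Let $\operatorname{Flag}(n_1,\dots,n_d;n)$ be the set of flags $\mathbb{V}_1 \subsetneq \dots \subsetneq \mathbb{V}_d$ of subspaces of $\mathbb{R}^n$ with $\dim \mathbb{V}_i = n_i$, with its usual structure of a smooth manifold (the charts are the inverses of the maps $x \mapsto A(1+x)\cdot\mathbb{E}$, where $A \in \operatorname{GL}_n(\mathbb{R})$, $x$ ranges over the matrices that are strictly block lower triangular for the block sizes $n_1, n_2-n_1, \dots, n-n_d$, and $\mathbb{E}$ is the flag spanned by the first $n_1,\dots,n_d$ standard basis vectors). Let $$\mathcal{P} = \{P=\operatorname{diag}(P_1,\dots,P_d)\in\mathbb{R}^{nd\times nd} : P_i\in\mathbb{R}^{n\times n},\ P_i^2 = P_i = P_i^{\mathsf T},\ \operatorname{tr}(P_i) = n_i,\ P_jP_i = P_i \text{ for } i<j\}.$$ Then $\mathcal{P}$ is an embedded smooth submanifold of $\mathbb{R}^{nd\times nd}$, and the map $$\operatorname{Flag}(n_1,\dots,n_d;n) \to \mathcal{P}, \qquad \{\mathbb{V}_i\}_{i=1}^d \mapsto \operatorname{diag}(V_1V_1^{\mathsf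 T},\dots,V_dV_d^{\mathsf T}),$$ where $V_i\in\mathbb{R}^{n\times n_i}$ is any matrix whose columns form an orthonormal basis of $\mathbb{V}_i$, is a diffeomorphism with inverse $P \mapsto \{\operatorname{im}(P_i)\}_{i=1}^d$. In particular, for each flag $\{\mathbb{V}_i\}_{i=1}^d$ there is exactly one $P\in\mathcal{P}$ with $\operatorname{im}(P_i)=\mathbb{V}_i$ for all $i$ (its projection coordinates). -/

import Mathlib

open scoped Manifold ContDiff Matrix

/-! ### Flags in `ℝⁿ` -/

/-- A flag of type `(n₁, …, n_d)` in `ℝⁿ`: a strictly increasing sequence of subspaces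
`V₁ ⊊ V₂ ⊊ ⋯ ⊊ V_d` with `dim Vᵢ = nᵢ`. -/
@[ext]
structure FlagManifold (n : ℕ) {d : ℕ} (ns : Fin d → ℕ) where
  V : Fin d → Submodule ℝ (Fin n → ℝ)
  strictMono : StrictMono V
  finrank_eq : ∀ i, Module.finrank ℝ (V i) = ns i

/-- The span of the first `k` standard basis vectors of `ℝⁿ`. -/
def coordSubspace (n k : ℕ) : Submodule ℝ (Fin n → ℝ) where
  carrier := {v | ∀ a : Fin n, k ≤ (a : ℕ) → v a = 0}
  add_mem' := by
    intro v w hv hw a ha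
    simp [hv a ha, hw a ha]
  zero_mem' := by
    intro a _
    rfl
  smul_mem' := by
    intro c v hv a ha
    simp [hv a ha]

/-- Positions `(a, b)` of an `n × n` matrix that lie strictly below the diagonal blocks of sizes
`n₁, n₂ - n₁, …, n - n_d`. -/
abbrev CellIndex (n : ℕ) {d : ℕ} (ns : Fin d → ℕ) : Type :=
  {p : Fin n × Fin n // ∃ i, (p.2 : ℕ) < ns i ∧ ns i ≤ (p.1 : ℕ)}

/-- The model space of the flag manifold: strictly block lower triangular matrices. -/
abbrev CellModel (n : ℕ) {d : ℕ} (ns : Fin d → ℕ) : Type :=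
  EuclideanSpace ℝ (CellIndex n ns)

/-- The block lower unipotent matrix `1 + x` attached to `x` in the model space. -/
def lowerUnipotent {n d : ℕ} {ns : Fin d → ℕ} (x : CellModel n ns) :
    Matrix (Fin n) (Fin n) ℝ :=
  Matrix.of fun a b =>
    if h : ∃ i, (b : ℕ) < ns i ∧ ns i ≤ (a : ℕ) then x ⟨(a, b), h⟩ else if a = b then 1 else 0

/-- `IsFrame A F`: the matrix `A` is invertible and, for each `i`, its first `nᵢ` columns span
the subspace `Vᵢ` of the flag `F`. -/
def IsFrame {n d : ℕ} {ns : Fin d → ℕ} (A : Matrix (Fin n) (Fin n) ℝ)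
    (F : FlagManifold n ns) : Prop :=
  A.det ≠ 0 ∧ ∀ i, F.V i = (coordSubspace n (ns i)).map A.mulVecLin

section Helpers

variable {n d : ℕ} {ns : Fin d → ℕ}

theorem mem_coordSubspace {k : ℕ} {v : Fin n → ℝ} :
    v ∈ coordSubspace n k ↔ ∀ a : Fin n, k ≤ (a : ℕ) → v a = 0 := Iff.rfl

theorem coordSubspace_mono {k l : ℕ} (h : k ≤ l) : coordSubspace n k ≤ coordSubspace n l :=
  fun _ hv a ha => hv a (h.trans ha)

theorem mulVecLin_injective_of_det {A : Matrix (Fin n) (Fin n) ℝ} (hA : A.det ≠ 0) :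
    Function.Injective A.mulVecLin :=
  Matrix.mulVec_injective_of_isUnit ((Matrix.isUnit_iff_isUnit_det A).2 (isUnit_iff_ne_zero.2 hA))

theorem finrank_map_of_det {A : Matrix (Fin n) (Fin n) ℝ} (hA : A.det ≠ 0)
    (W : Submodule ℝ (Fin n → ℝ)) :
    Module.finrank ℝ (W.map A.mulVecLin) = Module.finrank ℝ W :=
  (Submodule.equivMapOfInjective _ (mulVecLin_injective_of_det hA) W).finrank_eq.symm

/-- The `k`-th leading principal minor matrix of `M`, completed by the identity. -/
def leadingBlock (k : ℕ) (M : Matrix (Fin n) (Fin n) ℝ) : Matrix (Fin n) (Fin n) ℝ :=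
  Matrix.of fun a b => if (a : ℕ) < k ∧ (b : ℕ) < k then M a b else if a = b then 1 else 0

theorem leadingBlock_mulVec_of_le {k : ℕ} (M : Matrix (Fin n) (Fin n) ℝ) (v : Fin n → ℝ)
    {a : Fin n} (ha : k ≤ (a : ℕ)) : (leadingBlock k M *ᵥ v) a = v a := by
  simp [Matrix.mulVec, dotProduct, leadingBlock, Nat.not_lt.2 ha]

theorem leadingBlock_mulVec_of_lt {k : ℕ} (M : Matrix (Fin n) (Fin n) ℝ) {v : Fin n → ℝ}
    (hv : v ∈ coordSubspace n k) {a : Fin n} (ha : (a : ℕ) < k) :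
    (leadingBlock k M *ᵥ v) a = (M *ᵥ v) a := by
  simp only [Matrix.mulVec, dotProduct]
  refine Finset.sum_congr rfl fun b _ => ?_
  by_cases hb : (b : ℕ) < k
  · simp [leadingBlock, ha, hb]
  · rw [hv b (Nat.not_lt.1 hb)]
    simp

theorem mem_coordSubspace_of_leadingBlock {k : ℕ} {M : Matrix (Fin n) (Fin n) ℝ}
    {v w : Fin n → ℝ} (h : leadingBlock k M *ᵥ v = w) (hw : w ∈ coordSubspace n k) :
    v ∈ coordSubspace n k := fun a ha => by
  rw [← leadingBlock_mulVec_of_le M v ha, h, hw a ha]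

theorem lowerUnipotent_apply_of_lt (x : CellModel n ns) {a b : Fin n} (h : a < b) :
    lowerUnipotent x a b = 0 := by
  have h1 : ¬ ∃ i, (b : ℕ) < ns i ∧ ns i ≤ (a : ℕ) := by
    rintro ⟨i, h1, h2⟩
    have : (a : ℕ) < b := h
    omega
  simp [lowerUnipotent, h1, h.ne]

theorem lowerUnipotent_apply_self (x : CellModel n ns) (a : Fin n) :
    lowerUnipotent x a a = 1 := by
  have h1 : ¬ ∃ i, (a : ℕ) < ns i ∧ ns i ≤ (a : ℕ) := by
    rintro ⟨i, h1, h2⟩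
    omega
  simp [lowerUnipotent, h1]

theorem det_lowerUnipotent (x : CellModel n ns) : (lowerUnipotent x).det = 1 := by
  rw [Matrix.det_of_isLowerTriangular]
  · simp [lowerUnipotent_apply_self]
  · intro a b h
    exact lowerUnipotent_apply_of_lt x h

theorem det_leadingBlock_lowerUnipotent (k : ℕ) (x : CellModel n ns) :
    (leadingBlock k (lowerUnipotent x)).det = 1 := by
  rw [Matrix.det_of_isLowerTriangular]
  · refine Finset.prod_eq_one fun a _ => ?_
    simp [leadingBlock, lowerUnipotent_apply_self]
  · intro a b h
    have h' : a < b := h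
    simp [leadingBlock, lowerUnipotent_apply_of_lt x h', h'.ne]

/-- The end of the block of columns that contains the column `b`. -/
noncomputable def blockEnd (ns : Fin d → ℕ) (b : ℕ) : ℕ := sInf {m | b < m ∧ ∃ i, ns i = m}

theorem blockEnd_spec {b : ℕ} {i : Fin d} (h : b < ns i) :
    b < blockEnd ns b ∧ (∃ j, ns j = blockEnd ns b) ∧ blockEnd ns b ≤ ns i := by
  have hne : {m | b < m ∧ ∃ i, ns i = m}.Nonempty := ⟨ns i, h, i, rfl⟩
  have h1 := Nat.sInf_mem hne
  exact ⟨h1.1, h1.2, Nat.sInf_le ⟨h, i, rfl⟩⟩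

theorem lowerUnipotent_apply_of_lt_blockEnd (x : CellModel n ns) {a b : Fin n}
    (ha : (a : ℕ) < blockEnd ns b) : lowerUnipotent x a b = (Pi.single b 1 : Fin n → ℝ) a := by
  have h1 : ¬ ∃ i, (b : ℕ) < ns i ∧ ns i ≤ (a : ℕ) := by
    rintro ⟨i, h1, h2⟩
    have := (blockEnd_spec h1).2.2
    omega
  simp [lowerUnipotent, h1, Pi.single_apply]

theorem single_mem_coordSubspace {b : Fin n} {k : ℕ} (h : (b : ℕ) < k) :
    (Pi.single b 1 : Fin n → ℝ) ∈ coordSubspace n k := by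
  intro a ha
  have : a ≠ b := by
    rintro rfl
    omega
  simp [this]

/-- The coordinates, in the model space, of the flag spanned by the leading columns of `M`. -/
noncomputable def cellCoord (ns : Fin d → ℕ) (M : Matrix (Fin n) (Fin n) ℝ) : CellModel n ns :=
  WithLp.toLp 2 fun p => (M * (leadingBlock (blockEnd ns p.1.2) M)⁻¹) p.1.1 p.1.2

theorem det_leadingBlock_ne_zero {M : Matrix (Fin n) (Fin n) ℝ} (hM : M.det ≠ 0) {k : ℕ}
    {y : CellModel n ns}
    (h : (coordSubspace n k).map (lowerUnipotent y).mulVecLin =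
      (coordSubspace n k).map M.mulVecLin) : (leadingBlock k M).det ≠ 0 := by
  intro h0
  obtain ⟨v, hv0, hv⟩ := Matrix.exists_mulVec_eq_zero_iff.2 h0
  have hvC : v ∈ coordSubspace n k :=
    mem_coordSubspace_of_leadingBlock hv (Submodule.zero_mem _)
  have hmem : M *ᵥ v ∈ (coordSubspace n k).map (lowerUnipotent y).mulVecLin := by
    rw [h]
    exact ⟨v, hvC, rfl⟩
  obtain ⟨w, hwC, hw⟩ := hmem
  rw [Matrix.mulVecLin_apply] at hw
  have hLw : leadingBlock k (lowerUnipotent y) *ᵥ w = 0 := by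
    ext a
    by_cases ha : (a : ℕ) < k
    · rw [leadingBlock_mulVec_of_lt _ hwC ha, hw, ← leadingBlock_mulVec_of_lt M hvC ha, hv]
    · rw [leadingBlock_mulVec_of_le _ _ (Nat.not_lt.1 ha)]
      exact hwC a (Nat.not_lt.1 ha)
  have hw0 : w = 0 := by
    by_contra hne
    have := Matrix.exists_mulVec_eq_zero_iff.1 ⟨w, hne, hLw⟩
    rw [det_leadingBlock_lowerUnipotent] at this
    exact one_ne_zero this
  rw [hw0, Matrix.mulVec_zero] at hw
  exact hM (Matrix.exists_mulVec_eq_zero_iff.1 ⟨v, hv0, hw.symm⟩)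

theorem eq_cellCoord {M : Matrix (Fin n) (Fin n) ℝ} (hM : M.det ≠ 0) {y : CellModel n ns}
    (h : ∀ i, (coordSubspace n (ns i)).map (lowerUnipotent y).mulVecLin =
      (coordSubspace n (ns i)).map M.mulVecLin) : y = cellCoord ns M := by
  ext p
  obtain ⟨⟨a, b⟩, hp⟩ := p
  obtain ⟨i, hb, ha⟩ := hp
  obtain ⟨hbk, ⟨j, hj⟩, hki⟩ := blockEnd_spec hb
  have hj' := h j
  have hdet := det_leadingBlock_ne_zero hM hj'
  rw [hj] at hj' hdet
  set k := blockEnd ns (b : ℕ) with hk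
  have hmem : lowerUnipotent y *ᵥ Pi.single b 1 ∈ (coordSubspace n k).map M.mulVecLin := by
    rw [← hj']
    exact ⟨_, single_mem_coordSubspace hbk, rfl⟩
  obtain ⟨r, hrC, hr⟩ := hmem
  rw [Matrix.mulVecLin_apply] at hr
  have hTr : leadingBlock k M *ᵥ r = Pi.single b 1 := by
    ext c
    by_cases hc : (c : ℕ) < k
    · rw [leadingBlock_mulVec_of_lt _ hrC hc, hr, ← lowerUnipotent_apply_of_lt_blockEnd y hc]
      simp
    · rw [leadingBlock_mulVec_of_le _ _ (Nat.not_lt.1 hc), hrC c (Nat.not_lt.1 hc)]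
      exact (single_mem_coordSubspace hbk c (Nat.not_lt.1 hc)).symm
  have hr' : r = (leadingBlock k M)⁻¹ *ᵥ Pi.single b 1 := by
    rw [← hTr, Matrix.mulVec_mulVec, Matrix.nonsing_inv_mul _ (isUnit_iff_ne_zero.2 hdet),
      Matrix.one_mulVec]
  have h1 : lowerUnipotent y a b = y ⟨(a, b), ⟨i, hb, ha⟩⟩ := by
    have : ∃ i, (b : ℕ) < ns i ∧ ns i ≤ (a : ℕ) := ⟨i, hb, ha⟩
    simp [lowerUnipotent, this]
  have h2 : (M *ᵥ r) a = lowerUnipotent y a b := by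
    rw [hr]
    simp
  rw [← h1, ← h2, hr', Matrix.mulVec_mulVec]
  simp [cellCoord, hk]

theorem map_lowerUnipotent_cellCoord {M : Matrix (Fin n) (Fin n) ℝ} (hM : M.det ≠ 0)
    (h : ∀ i, (leadingBlock (ns i) M).det ≠ 0) (i : Fin d) :
    (coordSubspace n (ns i)).map (lowerUnipotent (cellCoord ns M)).mulVecLin =
      (coordSubspace n (ns i)).map M.mulVecLin := by
  have hcol : ∀ b : Fin n, (b : ℕ) < ns i →
      lowerUnipotent (cellCoord ns M) *ᵥ Pi.single b 1 ∈
        (coordSubspace n (ns i)).map M.mulVecLin := by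
    intro b hb
    obtain ⟨hbk, ⟨j, hj⟩, hki⟩ := blockEnd_spec hb
    have hdet := h j
    rw [hj] at hdet
    set k := blockEnd ns (b : ℕ) with hk
    set r := (leadingBlock k M)⁻¹ *ᵥ (Pi.single b 1 : Fin n → ℝ) with hr
    have hTr : leadingBlock k M *ᵥ r = Pi.single b 1 := by
      rw [hr, Matrix.mulVec_mulVec, Matrix.mul_nonsing_inv _ (isUnit_iff_ne_zero.2 hdet),
        Matrix.one_mulVec]
    have hrC : r ∈ coordSubspace n k :=
      mem_coordSubspace_of_leadingBlock hTr (single_mem_coordSubspace hbk)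
    refine ⟨r, coordSubspace_mono hki hrC, ?_⟩
    rw [Matrix.mulVecLin_apply]
    ext a
    have hL : (lowerUnipotent (cellCoord ns M) *ᵥ Pi.single b 1) a =
      lowerUnipotent (cellCoord ns M) a b := by simp
    rw [hL]
    by_cases ha : (a : ℕ) < k
    · rw [lowerUnipotent_apply_of_lt_blockEnd _ ha, ← leadingBlock_mulVec_of_lt _ hrC ha, hTr]
    · have hex : ∃ i, (b : ℕ) < ns i ∧ ns i ≤ (a : ℕ) :=
        ⟨j, by omega, by omega⟩
      rw [hr, Matrix.mulVec_mulVec]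
      simp [lowerUnipotent, hex, cellCoord, hk]
  refine Submodule.eq_of_le_of_finrank_eq ?_ ?_
  · rintro _ ⟨v, hv, rfl⟩
    have hsum : v = ∑ b, v b • (Pi.single b 1 : Fin n → ℝ) := by
      ext a
      simp [Finset.sum_apply, Pi.single_apply]
    rw [hsum, map_sum]
    refine Submodule.sum_mem _ fun b _ => ?_
    rw [map_smul]
    by_cases hb : (b : ℕ) < ns i
    · exact Submodule.smul_mem _ _ (hcol b hb)
    · rw [hv b (Nat.not_lt.1 hb), zero_smul]
      exact Submodule.zero_mem _
  · rw [finrank_map_of_det hM, finrank_map_of_det]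
    rw [det_lowerUnipotent]
    exact one_ne_zero

theorem finrank_coordSubspace_of_isFrame {A : Matrix (Fin n) (Fin n) ℝ} {F : FlagManifold n ns}
    (hA : IsFrame A F) (i : Fin d) : Module.finrank ℝ (coordSubspace n (ns i)) = ns i := by
  rw [← finrank_map_of_det hA.1, ← hA.2 i, F.finrank_eq]

theorem det_mul_lowerUnipotent {A : Matrix (Fin n) (Fin n) ℝ} (hA : A.det ≠ 0)
    (x : CellModel n ns) : (A * lowerUnipotent x).det ≠ 0 := by
  rwa [Matrix.det_mul, det_lowerUnipotent, mul_one]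

theorem strictMono_coordSubspace_of_isFrame {A : Matrix (Fin n) (Fin n) ℝ}
    {F : FlagManifold n ns} (hA : IsFrame A F) :
    StrictMono fun i => coordSubspace n (ns i) := by
  intro i j hij
  have h := F.strictMono hij
  rw [hA.2 i, hA.2 j] at h
  have hinj := mulVecLin_injective_of_det hA.1
  exact lt_of_le_of_ne ((Submodule.map_le_map_iff_of_injective hinj _ _).1 h.le)
    fun he => h.ne (congrArg (Submodule.map A.mulVecLin) he)

end Helpers

/-! ### The smooth structure on the set of flags -/

/-- The parametrized big cell `x ↦ A (1 + x) · (standard flag)` around a flag `F` with frame `A`: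
the `i`-th subspace is spanned by the first `nᵢ` columns of `A (1 + x)`. -/
def cellFlag {n d : ℕ} {ns : Fin d → ℕ} {A : Matrix (Fin n) (Fin n) ℝ} {F : FlagManifold n ns}
    (hA : IsFrame A F) (x : CellModel n ns) : FlagManifold n ns where
  V i := (coordSubspace n (ns i)).map (A * lowerUnipotent x).mulVecLin
  strictMono := (Submodule.map_strictMono_of_injective
    (mulVecLin_injective_of_det (det_mul_lowerUnipotent hA.1 x))).comp
      (strictMono_coordSubspace_of_isFrame hA)
  finrank_eq i := by
    rw [finrank_map_of_det (det_mul_lowerUnipotent hA.1 x), finrank_coordSubspace_of_isFrame hA]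

section Charts

variable {n d : ℕ} {ns : Fin d → ℕ}

theorem map_mul_eq_iff {A : Matrix (Fin n) (Fin n) ℝ} (hA : A.det ≠ 0)
    (L M : Matrix (Fin n) (Fin n) ℝ) (W : Submodule ℝ (Fin n → ℝ)) :
    W.map (A * L).mulVecLin = W.map M.mulVecLin ↔
      W.map L.mulVecLin = W.map (A⁻¹ * M).mulVecLin := by
  have hM : M = A * (A⁻¹ * M) := by
    rw [← mul_assoc, Matrix.mul_nonsing_inv _ (isUnit_iff_ne_zero.2 hA), one_mul]
  conv_lhs => rw [hM]
  rw [Matrix.mulVecLin_mul, Matrix.mulVecLin_mul A (A⁻¹ * M), Submodule.map_comp,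
    Submodule.map_comp]
  exact (Submodule.map_injective_of_injective (mulVecLin_injective_of_det hA)).eq_iff

theorem cellFlag_eq_iff {A B : Matrix (Fin n) (Fin n) ℝ} {F G : FlagManifold n ns}
    (hA : IsFrame A F) (hB : IsFrame B G) (x y : CellModel n ns) :
    cellFlag hB y = cellFlag hA x ↔
      ∀ i, (coordSubspace n (ns i)).map (lowerUnipotent y).mulVecLin =
        (coordSubspace n (ns i)).map (B⁻¹ * (A * lowerUnipotent x)).mulVecLin := by
  rw [FlagManifold.ext_iff, funext_iff]
  exact forall_congr' fun i => map_mul_eq_iff hB.1 _ _ _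

theorem det_transition {A B : Matrix (Fin n) (Fin n) ℝ} (hA : A.det ≠ 0) (hB : B.det ≠ 0)
    (x : CellModel n ns) : (B⁻¹ * (A * lowerUnipotent x)).det ≠ 0 := by
  rw [Matrix.det_mul]
  refine mul_ne_zero ?_ (det_mul_lowerUnipotent hA x)
  rw [Matrix.det_nonsing_inv, Ring.inverse_eq_inv']
  exact inv_ne_zero hB

theorem cellFlag_injective {A : Matrix (Fin n) (Fin n) ℝ} {F : FlagManifold n ns}
    (hA : IsFrame A F) : Function.Injective (cellFlag hA) := by
  intro x y hxy
  have hd := det_transition hA.1 hA.1 y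
  rw [eq_cellCoord hd ((cellFlag_eq_iff hA hA y x).1 hxy),
    ← eq_cellCoord hd ((cellFlag_eq_iff hA hA y y).1 rfl)]

/-- The chart of the flag manifold whose inverse is the parametrized big cell `cellFlag`. -/
noncomputable def cellChart {A : Matrix (Fin n) (Fin n) ℝ} {F : FlagManifold n ns}
    (hA : IsFrame A F) : PartialEquiv (FlagManifold n ns) (CellModel n ns) where
  toFun := Function.invFun (cellFlag hA)
  invFun := cellFlag hA
  source := Set.range (cellFlag hA)
  target := Set.univ
  map_source' _ _ := Set.mem_univ _
  map_target' x _ := ⟨x, rfl⟩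
  left_inv' _ h := Function.invFun_eq h
  right_inv' x _ := Function.leftInverse_invFun (cellFlag_injective hA) x

theorem mem_transition_source {A B : Matrix (Fin n) (Fin n) ℝ} {F G : FlagManifold n ns}
    (hA : IsFrame A F) (hB : IsFrame B G) (x : CellModel n ns) :
    x ∈ ((cellChart hA).symm.trans (cellChart hB)).source ↔
      ∀ i, (leadingBlock (ns i) (B⁻¹ * (A * lowerUnipotent x))).det ≠ 0 := by
  have h1 : x ∈ ((cellChart hA).symm.trans (cellChart hB)).source ↔
      ∃ y, cellFlag hB y = cellFlag hA x := by
    simp only [PartialEquiv.trans_source, cellChart, Set.mem_inter_iff, Set.mem_preimage,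
      Set.mem_range]
    exact ⟨fun h => h.2, fun h => ⟨Set.mem_univ _, h⟩⟩
  have hd := det_transition hA.1 hB.1 x
  rw [h1]
  constructor
  · rintro ⟨y, hy⟩ i
    exact det_leadingBlock_ne_zero hd ((cellFlag_eq_iff hA hB x y).1 hy i)
  · intro h
    exact ⟨_, (cellFlag_eq_iff hA hB x _).2 (map_lowerUnipotent_cellCoord hd h)⟩

theorem transition_apply {A B : Matrix (Fin n) (Fin n) ℝ} {F G : FlagManifold n ns}
    (hA : IsFrame A F) (hB : IsFrame B G) {x : CellModel n ns}
    (hx : x ∈ ((cellChart hA).symm.trans (cellChart hB)).source) :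
    ((cellChart hA).symm.trans (cellChart hB)) x =
      cellCoord ns (B⁻¹ * (A * lowerUnipotent x)) := by
  have hd := det_transition hA.1 hB.1 x
  have h := (mem_transition_source hA hB x).1 hx
  have h2 := (cellFlag_eq_iff hA hB x _).2 (map_lowerUnipotent_cellCoord hd h)
  change Function.invFun (cellFlag hB) (cellFlag hA x) = _
  rw [← h2]
  exact Function.leftInverse_invFun (cellFlag_injective hB) _

theorem contDiff_lowerUnipotent (a b : Fin n) :
    ContDiff ℝ ∞ fun x : CellModel n ns => lowerUnipotent x a b := by
  by_cases h : ∃ i, (b : ℕ) < ns i ∧ ns i ≤ (a : ℕ)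
  · simp only [lowerUnipotent, h, Matrix.of_apply, dite_true]
    exact contDiff_euclidean.1 contDiff_id _
  · simp only [lowerUnipotent, h, Matrix.of_apply, dite_false]
    exact contDiff_const

theorem contDiff_mul_entry {E : Type*} [NormedAddCommGroup E] [NormedSpace ℝ E]
    {M N : E → Matrix (Fin n) (Fin n) ℝ} (hM : ∀ a b, ContDiff ℝ ∞ fun x => M x a b)
    (hN : ∀ a b, ContDiff ℝ ∞ fun x => N x a b) (a b : Fin n) :
    ContDiff ℝ ∞ fun x => (M x * N x) a b := by
  simp only [Matrix.mul_apply]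
  exact ContDiff.sum fun c _ => (hM a c).mul (hN c b)

theorem contDiff_det_entry {E : Type*} [NormedAddCommGroup E] [NormedSpace ℝ E]
    {M : E → Matrix (Fin n) (Fin n) ℝ} (hM : ∀ a b, ContDiff ℝ ∞ fun x => M x a b) :
    ContDiff ℝ ∞ fun x => (M x).det := by
  simp only [Matrix.det_apply']
  exact ContDiff.sum fun σ _ => contDiff_const.mul (contDiff_prod fun c _ => hM _ _)

theorem contDiff_leadingBlock_entry {E : Type*} [NormedAddCommGroup E] [NormedSpace ℝ E]
    {M : E → Matrix (Fin n) (Fin n) ℝ} (hM : ∀ a b, ContDiff ℝ ∞ fun x => M x a b) (k : ℕ)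
    (a b : Fin n) : ContDiff ℝ ∞ fun x => leadingBlock k (M x) a b := by
  by_cases h : (a : ℕ) < k ∧ (b : ℕ) < k
  · simpa only [leadingBlock, Matrix.of_apply, h, and_self, if_true] using hM a b
  · simp only [leadingBlock, Matrix.of_apply, h, if_false]
    exact contDiff_const

theorem contDiffOn_inv_entry {E : Type*} [NormedAddCommGroup E] [NormedSpace ℝ E]
    {M : E → Matrix (Fin n) (Fin n) ℝ} (hM : ∀ a b, ContDiff ℝ ∞ fun x => M x a b)
    {s : Set E} (hs : ∀ x ∈ s, (M x).det ≠ 0) (a b : Fin n) :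
    ContDiffOn ℝ ∞ (fun x => (M x)⁻¹ a b) s := by
  simp only [Matrix.inv_def, Matrix.smul_apply, Ring.inverse_eq_inv', smul_eq_mul,
    Matrix.adjugate_apply]
  refine ContDiffOn.mul ((contDiff_det_entry hM).contDiffOn.inv hs) (ContDiff.contDiffOn ?_)
  refine contDiff_det_entry fun c e => ?_
  by_cases hc : c = b
  · subst hc
    simp only [Matrix.updateRow_self]
    exact contDiff_const
  · simp only [Matrix.updateRow_ne hc]
    exact hM c e

theorem contDiff_transition_entry (A B : Matrix (Fin n) (Fin n) ℝ) (a b : Fin n) :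
    ContDiff ℝ ∞ fun x : CellModel n ns => (B⁻¹ * (A * lowerUnipotent x)) a b :=
  contDiff_mul_entry (M := fun _ => B⁻¹) (fun _ _ => contDiff_const)
    (contDiff_mul_entry (M := fun _ => A) (fun _ _ => contDiff_const) contDiff_lowerUnipotent) a b

theorem isOpen_transition_source {A B : Matrix (Fin n) (Fin n) ℝ} {F G : FlagManifold n ns}
    (hA : IsFrame A F) (hB : IsFrame B G) :
    IsOpen ((cellChart hA).symm.trans (cellChart hB)).source := by
  have : ((cellChart hA).symm.trans (cellChart hB)).source =
      ⋂ i, {x | (leadingBlock (ns i) (B⁻¹ * (A * lowerUnipotent x))).det ≠ 0} := by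
    ext x
    rw [mem_transition_source]
    simp
  rw [this]
  refine isOpen_iInter_of_finite fun i => ?_
  exact isOpen_ne_fun (contDiff_det_entry (contDiff_leadingBlock_entry
    (contDiff_transition_entry A B) _)).continuous continuous_const

theorem contDiffOn_transition {A B : Matrix (Fin n) (Fin n) ℝ} {F G : FlagManifold n ns}
    (hA : IsFrame A F) (hB : IsFrame B G) :
    ContDiffOn ℝ ∞ ((cellChart hA).symm.trans (cellChart hB))
      ((cellChart hA).symm.trans (cellChart hB)).source := by
  refine ContDiffOn.congr (f := fun x => cellCoord ns (B⁻¹ * (A * lowerUnipotent x))) ?_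
    fun x hx => transition_apply hA hB hx
  rw [contDiffOn_euclidean]
  rintro ⟨⟨a, b⟩, ⟨i, hb, ha⟩⟩
  obtain ⟨-, ⟨j, hj⟩, -⟩ := blockEnd_spec hb
  have hsum : ∀ x : CellModel n ns,
      cellCoord ns (B⁻¹ * (A * lowerUnipotent x)) ⟨(a, b), ⟨i, hb, ha⟩⟩ =
        ∑ c, (B⁻¹ * (A * lowerUnipotent x)) a c *
          (leadingBlock (blockEnd ns b) (B⁻¹ * (A * lowerUnipotent x)))⁻¹ c b :=
    fun x => Matrix.mul_apply
  simp only [hsum]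
  refine ContDiffOn.sum fun c _ =>
    (contDiff_transition_entry A B a c).contDiffOn.mul ?_
  refine contDiffOn_inv_entry (contDiff_leadingBlock_entry (contDiff_transition_entry A B) _)
    (fun x hx => ?_) _ _
  have := (mem_transition_source hA hB x).1 hx j
  rwa [hj] at this

theorem exists_linearIndependent_adapted (F : FlagManifold n ns) (k : ℕ) (hk : k ≤ n) :
    ∃ v : Fin k → (Fin n → ℝ), LinearIndependent ℝ v ∧
      ∀ i, ∀ a : Fin k, (a : ℕ) < ns i → v a ∈ F.V i := by
  induction k with
  | zero => exact ⟨Fin.elim0, linearIndependent_empty_type, fun _ a => a.elim0⟩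
  | succ k ih =>
    obtain ⟨v, hv, hvF⟩ := ih (Nat.le_of_succ_le hk)
    have hspan : Module.finrank ℝ (Submodule.span ℝ (Set.range v)) = k := by
      rw [finrank_span_eq_card hv, Fintype.card_fin]
    have key : ∃ w, w ∉ Submodule.span ℝ (Set.range v) ∧ ∀ i, k < ns i → w ∈ F.V i := by
      by_cases h : ∃ i, k < ns i
      · obtain ⟨i, hi, hmin⟩ : ∃ i, k < ns i ∧ ∀ j, k < ns j → i ≤ j := by
          have hne : (Finset.univ.filter fun i => k < ns i).Nonempty := by
            obtain ⟨i, hi⟩ := h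
            exact ⟨i, by simp [hi]⟩
          refine ⟨Finset.min' _ hne, ?_, fun j hj => Finset.min'_le _ _ (by simp [hj])⟩
          simpa using Finset.min'_mem _ hne
        have hnle : ¬ F.V i ≤ Submodule.span ℝ (Set.range v) := fun hle => by
          have := Submodule.finrank_mono hle
          rw [hspan, F.finrank_eq] at this
          omega
        obtain ⟨w, hw, hw'⟩ := SetLike.not_le_iff_exists.1 hnle
        exact ⟨w, hw', fun j hj => F.strictMono.monotone (hmin j hj) hw⟩
      · have hne : Submodule.span ℝ (Set.range v) ≠ ⊤ := fun htop => by
          rw [htop, finrank_top, Module.finrank_fin_fun] at hspan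
          omega
        obtain ⟨w, -, hw⟩ := SetLike.exists_of_lt (lt_top_iff_ne_top.2 hne)
        exact ⟨w, hw, fun i hi => (h ⟨i, hi⟩).elim⟩
    obtain ⟨w, hw, hwF⟩ := key
    refine ⟨Fin.snoc v w, hv.finSnoc hw, fun i a => ?_⟩
    refine Fin.lastCases ?_ (fun b => ?_) a
    · intro h
      simpa using hwF i (by simpa using h)
    · intro h
      simpa using hvF i b (by simpa using h)

theorem finrank_coordSubspace {k : ℕ} (hk : k ≤ n) :
    Module.finrank ℝ (coordSubspace n k) = k := by
  have h : coordSubspace n k = Submodule.span ℝ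
      (Set.range fun a : Fin k => (Pi.single (Fin.castLE hk a) 1 : Fin n → ℝ)) := by
    refine le_antisymm (fun v hv => ?_) (Submodule.span_le.2 ?_)
    · have hsum : v = ∑ b, v b • (Pi.single b 1 : Fin n → ℝ) := by
        ext a
        simp [Finset.sum_apply, Pi.single_apply]
      rw [hsum]
      refine Submodule.sum_mem _ fun b _ => ?_
      by_cases hb : (b : ℕ) < k
      · exact Submodule.smul_mem _ _ (Submodule.subset_span ⟨⟨b, hb⟩, rfl⟩)
      · rw [hv b (Nat.not_lt.1 hb), zero_smul]
        exact Submodule.zero_mem _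
    · rintro _ ⟨a, rfl⟩
      exact single_mem_coordSubspace a.2
  have hli := (Pi.basisFun ℝ (Fin n)).linearIndependent.comp _ (Fin.castLE_injective hk)
  have hli' : LinearIndependent ℝ
      (fun a : Fin k => (Pi.single (Fin.castLE hk a) 1 : Fin n → ℝ)) := by
    simpa [Function.comp_def] using hli
  rw [h, finrank_span_eq_card hli', Fintype.card_fin]

theorem exists_isFrame (F : FlagManifold n ns) : ∃ A, IsFrame A F := by
  obtain ⟨v, hv, hvF⟩ := exists_linearIndependent_adapted F n le_rfl
  have hA : (Matrix.of v)ᵀ.det ≠ 0 := by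
    rw [Matrix.det_transpose]
    have : IsUnit (Matrix.of v) := Matrix.linearIndependent_rows_iff_isUnit.1 hv
    exact ((Matrix.isUnit_iff_isUnit_det _).1 this).ne_zero
  refine ⟨(Matrix.of v)ᵀ, hA, fun i => ?_⟩
  have hle : (coordSubspace n (ns i)).map (Matrix.of v)ᵀ.mulVecLin ≤ F.V i := by
    rintro _ ⟨c, hc, rfl⟩
    have : (Matrix.of v)ᵀ.mulVecLin c = ∑ b, c b • v b := by
      ext a
      simp only [Matrix.mulVecLin_apply, Matrix.mulVec, dotProduct, Matrix.transpose_apply,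
        Matrix.of_apply, Finset.sum_apply, Pi.smul_apply, smul_eq_mul]
      exact Finset.sum_congr rfl fun _ _ => mul_comm _ _
    rw [this]
    refine Submodule.sum_mem _ fun b _ => ?_
    by_cases hb : (b : ℕ) < ns i
    · exact Submodule.smul_mem _ _ (hvF i b hb)
    · rw [hc b (Nat.not_lt.1 hb), zero_smul]
      exact Submodule.zero_mem _
  refine (Submodule.eq_of_le_of_finrank_eq hle ?_).symm
  have hn : ns i ≤ n := by
    have := Submodule.finrank_le (F.V i)
    rwa [F.finrank_eq, Module.finrank_fin_fun] at this
  rw [finrank_map_of_det hA, F.finrank_eq, finrank_coordSubspace hn]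

theorem mem_cellChart_source {A : Matrix (Fin n) (Fin n) ℝ} {F : FlagManifold n ns}
    (hA : IsFrame A F) : F ∈ (cellChart hA).source := by
  have h0 : lowerUnipotent (0 : CellModel n ns) = 1 := by
    ext a b
    by_cases h : ∃ i, (b : ℕ) < ns i ∧ ns i ≤ (a : ℕ)
    · have hab : a ≠ b := by
        rintro rfl
        obtain ⟨i, h1, h2⟩ := h
        omega
      simp [lowerUnipotent, h, hab]
    · simp [lowerUnipotent, h, Matrix.one_apply]
  refine ⟨0, FlagManifold.ext (funext fun i => ?_)⟩
  change (coordSubspace n (ns i)).map (A * lowerUnipotent (0 : CellModel n ns)).mulVecLin = _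
  rw [h0, mul_one, hA.2 i]

end Charts

/-- The atlas of big cells `x ↦ A (1 + x) · (standard flag)`, `A` an invertible matrix. -/
noncomputable def flagChartedSpaceCore (n : ℕ) {d : ℕ} (ns : Fin d → ℕ) :
    ChartedSpaceCore (CellModel n ns) (FlagManifold n ns) where
  atlas := {e | ∃ (A : Matrix (Fin n) (Fin n) ℝ) (F : FlagManifold n ns) (hA : IsFrame A F),
    e = cellChart hA}
  chartAt F := cellChart (exists_isFrame F).choose_spec
  mem_chart_source F := mem_cellChart_source (exists_isFrame F).choose_spec
  chart_mem_atlas F := ⟨_, F, (exists_isFrame F).choose_spec, rfl⟩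
  open_source := by
    rintro _ _ ⟨A, F, hA, rfl⟩ ⟨B, G, hB, rfl⟩
    exact isOpen_transition_source hA hB
  continuousOn_toFun := by
    rintro _ _ ⟨A, F, hA, rfl⟩ ⟨B, G, hB, rfl⟩
    exact (contDiffOn_transition hA hB).continuousOn

noncomputable instance flagTopologicalSpace (n : ℕ) {d : ℕ} (ns : Fin d → ℕ) :
    TopologicalSpace (FlagManifold n ns) :=
  (flagChartedSpaceCore n ns).toTopologicalSpace

noncomputable instance flagChartedSpace (n : ℕ) {d : ℕ} (ns : Fin d → ℕ) :
    ChartedSpace (CellModel n ns) (FlagManifold n ns) :=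
  (flagChartedSpaceCore n ns).toChartedSpace

instance flagIsManifold (n : ℕ) {d : ℕ} (ns : Fin d → ℕ) :
    IsManifold 𝓘(ℝ, CellModel n ns) ∞ (FlagManifold n ns) := by
  refine isManifold_of_contDiffOn _ _ _ fun e e' he he' => ?_
  obtain ⟨_, ⟨p, rfl⟩, hp⟩ := he
  obtain ⟨_, ⟨q, rfl⟩, hq⟩ := he'
  obtain ⟨_, ⟨⟨A, F, hA, rfl⟩, rfl⟩, rfl⟩ := hp
  obtain ⟨_, ⟨⟨B, G, hB, rfl⟩, rfl⟩, rfl⟩ := hq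
  refine (contDiffOn_transition hA hB).mono ?_
  exact Set.inter_subset_left

/-! ### Projection matrices -/

/-- The set of block-diagonal matrices `diag(P₁, …, P_d)` of size `nd × nd` such that each `Pᵢ` is
an orthogonal projector (`Pᵢ² = Pᵢ = Pᵢᵀ`) of trace `nᵢ`, and `Pⱼ Pᵢ = Pᵢ` for `i < j`.
Rows and columns are indexed by pairs (index inside the block, number of the block). -/
def projectionFlags (n : ℕ) {d : ℕ} (ns : Fin d → ℕ) :
    Set (Matrix (Fin n × Fin d) (Fin n × Fin d) ℝ) :=
  {M | ∃ P : Fin d → Matrix (Fin n) (Fin n) ℝ, M = Matrix.blockDiagonal P ∧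
    (∀ i, P i * P i = P i ∧ (P i)ᵀ = P i ∧ (P i).trace = (ns i : ℝ)) ∧
    ∀ i j, i < j → P j * P i = P i}

/-! A subspace and the orthogonal projector onto it determine each other (`projector_ext`). The
trace of a projector is the dimension of its range, and `P_j P_i = P_i` says that the range of `P_i`
lies in that of `P_j`. Flags and tuples of projectors therefore correspond bijectively
(`flagEquiv`).

For smoothness, fix a frame `A` and let `B = A (1 + x)` run through its big cell. If `V` consists of
the first `k` columns of `B`, the projector is `V (Vᵀ V)⁻¹ Vᵀ`. In `frameProj` the `k × k` Gram
block is padded by the identity, so that all matrices stay of size `n × n`. Gram blocks of an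
invertible matrix are invertible, so the projector is a smooth function of `x`
(`contDiff_frameVector_cell`).

Conversely, `x` is a rational function of the projectors. Write `C = A⁻¹ B`, `D = coordProj n k`,
`G` for the padded Gram block and `L` for the leading block of `C`. Then `A⁻¹ P A⁻ᵀ = C D G⁻¹ D Cᵀ`
has leading block `L G⁻¹ Lᵀ`, and normalizing its leading columns by this block gives the same
columns as `C L⁻¹`, whose entries are the cell coordinates. Thus `cellRead` is smooth on an open set
of the whole ambient space, and that set meets the tuples of projectors exactly in the cell
(`frameVector_cell_mem`, `cellFlag_cellRead`).

Hence `flagEquiv` is a homeomorphism, and each cell parametrization is a smooth map with a smooth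
left inverse, so ambient charts straighten it (`exists_chart_straightening`). The manifold structure
on the projectors is the one carried over from the flags. With it the diffeomorphism is automatic,
and the content is that the inclusion into the matrices is a smooth embedding. -/

/-! ### Orthogonal projectors -/

section Idempotent

variable {R : Type*} [Ring R]

/-- If `e` is idempotent and `x` fixes `1 - e` on both sides, then compressing by `e` and completing
by `1 - e` is multiplicative around `x`. -/
theorem compress_mul_mul_compress {e x : R} (he : e * e = e) (hl : (1 - e) * x = 1 - e)
    (hr : x * (1 - e) = 1 - e) (c b : R) :
    (e * c * e + (1 - e)) * x * (e * b * e + (1 - e)) =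
      e * (c * e * x * e * b) * e + (1 - e) := by
  have h1 : e * (1 - e) = 0 := by rw [mul_sub, he, mul_one, sub_self]
  have h2 : (1 - e) * e = 0 := by rw [sub_mul, he, one_mul, sub_self]
  have h3 : (1 - e) * (1 - e) = 1 - e := by rw [sub_mul, h1, one_mul, sub_zero]
  have hA : e * c * e * x * (1 - e) = 0 := by rw [mul_assoc _ x, hr, mul_assoc, h1, mul_zero]
  have hB : (1 - e) * x * (e * b * e) = 0 := by
    rw [hl, mul_assoc e b, ← mul_assoc, h2, zero_mul]
  rw [add_mul, add_mul, mul_add, mul_add, hA, hB, hl, h3, add_zero, zero_add]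
  simp only [mul_assoc]

end Idempotent

section Projector

variable {n : ℕ}

/-- An idempotent is the identity on its range, and every column of `Q` lies there. -/
theorem mul_eq_right_of_range_le {m k : Type*} [Fintype m] [Fintype k]
    [DecidableEq k]
    {P : Matrix m m ℝ} (hP : P * P = P) {Q : Matrix m k ℝ}
    (h : LinearMap.range Q.mulVecLin ≤ LinearMap.range P.mulVecLin) : P * Q = Q := by
  refine Matrix.ext_of_mulVec_single fun b => ?_
  obtain ⟨w, hw⟩ := h (LinearMap.mem_range_self Q.mulVecLin (Pi.single b 1))
  rw [Matrix.mulVecLin_apply, Matrix.mulVecLin_apply] at hw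
  rw [← Matrix.mulVec_mulVec, ← hw, Matrix.mulVec_mulVec, hP]

theorem range_le_of_mul_eq_right {m k : Type*} [Fintype m] [Fintype k]
    {P : Matrix m m ℝ} {Q : Matrix m k ℝ} (h : P * Q = Q) :
    LinearMap.range Q.mulVecLin ≤ LinearMap.range P.mulVecLin := by
  rintro _ ⟨v, rfl⟩
  exact ⟨Q.mulVecLin v, by rw [Matrix.mulVecLin_apply, Matrix.mulVecLin_apply, Matrix.mulVec_mulVec, h]⟩

/-- An orthogonal projector is determined by its range. -/
theorem projector_ext {m : Type*} [Fintype m] [DecidableEq m] {P Q : Matrix m m ℝ}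
    (hP : P * P = P) (hPt : Pᵀ = P)
    (hQ : Q * Q = Q) (hQt : Qᵀ = Q)
    (h : LinearMap.range P.mulVecLin = LinearMap.range Q.mulVecLin) : P = Q := by
  have h1 : P * Q = Q := mul_eq_right_of_range_le hP h.ge
  have h2 : Q * P = P := mul_eq_right_of_range_le hQ h.le
  calc P = (Q * P)ᵀ := by rw [h2, hPt]
    _ = Q := by rw [Matrix.transpose_mul, hPt, hQt, h1]

theorem trace_eq_finrank_range {m : Type*} [Fintype m] [DecidableEq m] {P : Matrix m m ℝ}
    (hP : P * P = P) :
    P.trace = Module.finrank ℝ (LinearMap.range P.mulVecLin) := by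
  have hi : IsIdempotentElem P.mulVecLin := by
    rw [IsIdempotentElem, Module.End.mul_eq_comp, ← Matrix.mulVecLin_mul, hP]
  have := (LinearMap.IsIdempotentElem.isProj_range P.mulVecLin hi).trace
  rw [← this, ← Matrix.toLin'_apply', Matrix.trace_toLin'_eq]

/-- The projection onto the first `k` coordinates, as a matrix. -/
def coordProj (n k : ℕ) : Matrix (Fin n) (Fin n) ℝ :=
  Matrix.diagonal fun a => if (a : ℕ) < k then 1 else 0

theorem coordProj_mul_self (k : ℕ) : coordProj n k * coordProj n k = coordProj n k := by
  simp [coordProj, Matrix.diagonal_mul_diagonal]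

theorem coordProj_transpose (k : ℕ) : (coordProj n k)ᵀ = coordProj n k :=
  Matrix.diagonal_transpose _

theorem range_coordProj (k : ℕ) :
    LinearMap.range (coordProj n k).mulVecLin = coordSubspace n k := by
  ext v
  constructor
  · rintro ⟨w, rfl⟩ a ha
    simp [coordProj, Matrix.mulVec_diagonal, Nat.not_lt.2 ha]
  · intro hv
    refine ⟨v, funext fun a => ?_⟩
    by_cases ha : (a : ℕ) < k
    · simp [coordProj, Matrix.mulVec_diagonal, ha]
    · simp [coordProj, Matrix.mulVec_diagonal, ha, hv a (Nat.not_lt.1 ha)]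

/-- Turns the entrywise definition into a compression by an idempotent, so that products and
inverses of leading blocks become ring identities. -/
theorem leadingBlock_eq (k : ℕ) (M : Matrix (Fin n) (Fin n) ℝ) :
    leadingBlock k M = coordProj n k * M * coordProj n k + (1 - coordProj n k) := by
  ext a b
  rcases eq_or_ne a b with rfl | hab
  · by_cases ha : (a : ℕ) < k <;> simp [leadingBlock, coordProj, ha]
  · by_cases ha : (a : ℕ) < k <;> by_cases hb : (b : ℕ) < k <;>
      simp [leadingBlock, coordProj, ha, hb, hab]

theorem leadingBlock_mul_compl (k : ℕ) (M : Matrix (Fin n) (Fin n) ℝ) :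
    leadingBlock k M * (1 - coordProj n k) = 1 - coordProj n k := by
  have h := coordProj_mul_self (n := n) k
  have h1 : coordProj n k * (1 - coordProj n k) = 0 := by rw [mul_sub, h, mul_one, sub_self]
  rw [leadingBlock_eq, add_mul, mul_assoc, h1, mul_zero, zero_add, sub_mul, h1, one_mul, sub_zero]

theorem compl_mul_leadingBlock (k : ℕ) (M : Matrix (Fin n) (Fin n) ℝ) :
    (1 - coordProj n k) * leadingBlock k M = 1 - coordProj n k := by
  have h := coordProj_mul_self (n := n) k
  have h1 : (1 - coordProj n k) * coordProj n k = 0 := by rw [sub_mul, h, one_mul, sub_self]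
  rw [leadingBlock_eq, mul_add, ← mul_assoc, ← mul_assoc, h1, zero_mul, zero_mul, zero_add, mul_sub,
    h1, mul_one, sub_zero]

theorem coordProj_mul_leadingBlock (k : ℕ) (M : Matrix (Fin n) (Fin n) ℝ) :
    coordProj n k * leadingBlock k M = coordProj n k * M * coordProj n k := by
  have h := coordProj_mul_self (n := n) k
  rw [leadingBlock_eq, mul_add, mul_sub, h, mul_one, sub_self, add_zero, ← mul_assoc, ← mul_assoc,
    h]

theorem leadingBlock_transpose (k : ℕ) (M : Matrix (Fin n) (Fin n) ℝ) :
    (leadingBlock k M)ᵀ = leadingBlock k Mᵀ := by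
  simp [leadingBlock_eq, Matrix.transpose_mul, coordProj_transpose, mul_assoc]

/-! ### Inverses of leading blocks and Gram matrices -/

section Inverse

variable {k : ℕ} {M : Matrix (Fin n) (Fin n) ℝ}

theorem leadingBlock_inv_mul_compl (h : (leadingBlock k M).det ≠ 0) :
    (leadingBlock k M)⁻¹ * (1 - coordProj n k) = 1 - coordProj n k := by
  conv_lhs => rw [← leadingBlock_mul_compl k M]
  rw [← mul_assoc, Matrix.nonsing_inv_mul _ (isUnit_iff_ne_zero.2 h), one_mul]

theorem compl_mul_leadingBlock_inv (h : (leadingBlock k M).det ≠ 0) :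
    (1 - coordProj n k) * (leadingBlock k M)⁻¹ = 1 - coordProj n k := by
  conv_lhs => rw [← compl_mul_leadingBlock k M]
  rw [mul_assoc, Matrix.mul_nonsing_inv _ (isUnit_iff_ne_zero.2 h), mul_one]

/-- The inverse fixes `1 - D` from both sides, so it commutes with `1 - D` and hence with `D`. -/
theorem leadingBlock_inv_mul_coordProj (h : (leadingBlock k M).det ≠ 0) :
    (leadingBlock k M)⁻¹ * coordProj n k = coordProj n k * (leadingBlock k M)⁻¹ := by
  have h1 := leadingBlock_inv_mul_compl h
  have h2 := compl_mul_leadingBlock_inv h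
  rw [mul_sub, mul_one] at h1
  rw [sub_mul, one_mul] at h2
  exact sub_right_injective (h1.trans h2.symm)

/-- The leading blocks of the Gram matrix of an invertible matrix are nonsingular. -/
theorem det_leadingBlock_gram_ne_zero (k : ℕ) (hM : M.det ≠ 0) :
    (leadingBlock k (Mᵀ * M)).det ≠ 0 := by
  intro h0
  obtain ⟨v, hv0, hv⟩ := Matrix.exists_mulVec_eq_zero_iff.2 h0
  have hvC : v ∈ coordSubspace n k :=
    mem_coordSubspace_of_leadingBlock hv (Submodule.zero_mem _)
  -- This number is `|M v|²`. Coordinates below `k` contribute nothing because the leading block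
  -- kills `v`, the others because `v` vanishes there.
  have hd : v ⬝ᵥ ((Mᵀ * M) *ᵥ v) = 0 := by
    refine Finset.sum_eq_zero fun a _ => ?_
    by_cases ha : (a : ℕ) < k
    · rw [← leadingBlock_mulVec_of_lt _ hvC ha, hv, Pi.zero_apply, mul_zero]
    · rw [hvC a (Nat.not_lt.1 ha), zero_mul]
  rw [← Matrix.mulVec_mulVec, Matrix.dotProduct_mulVec, Matrix.vecMul_transpose,
    dotProduct_self_eq_zero] at hd
  exact hM (Matrix.exists_mulVec_eq_zero_iff.1 ⟨v, hv0, hd⟩)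

end Inverse

/-- The orthogonal projector onto the span of the first `k` columns of the invertible matrix `M`. -/
noncomputable def frameProj (k : ℕ) (M : Matrix (Fin n) (Fin n) ℝ) : Matrix (Fin n) (Fin n) ℝ :=
  M * coordProj n k * (leadingBlock k (Mᵀ * M))⁻¹ * coordProj n k * Mᵀ

theorem frameProj_transpose (k : ℕ) (M : Matrix (Fin n) (Fin n) ℝ) :
    (frameProj k M)ᵀ = frameProj k M := by
  simp only [frameProj, Matrix.transpose_mul, coordProj_transpose, Matrix.transpose_transpose,
    Matrix.transpose_nonsing_inv, leadingBlock_transpose, mul_assoc]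

/-- The factor `D Mᵀ M D` that appears equals `D` times the padded Gram block, and `D` commutes with
the inverse of that block, so the two cancel. Idempotence and the range of the projector both follow
from this. -/
theorem frameProj_mul_frame {M : Matrix (Fin n) (Fin n) ℝ} (hM : M.det ≠ 0) (k : ℕ) :
    frameProj k M * (M * coordProj n k) = M * coordProj n k := by
  have hG := det_leadingBlock_gram_ne_zero k hM
  have h1 := coordProj_mul_leadingBlock k (Mᵀ * M)
  calc frameProj k M * (M * coordProj n k)
      = M * coordProj n k * (leadingBlock k (Mᵀ * M))⁻¹ *
          (coordProj n k * (Mᵀ * M) * coordProj n k) := by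
        simp only [frameProj, mul_assoc]
    _ = M * coordProj n k * ((leadingBlock k (Mᵀ * M))⁻¹ * coordProj n k) *
          leadingBlock k (Mᵀ * M) := by rw [← h1]; simp only [mul_assoc]
    _ = M * (coordProj n k * coordProj n k) *
          ((leadingBlock k (Mᵀ * M))⁻¹ * leadingBlock k (Mᵀ * M)) := by
        rw [leadingBlock_inv_mul_coordProj hG]; simp only [mul_assoc]
    _ = _ := by
        rw [Matrix.nonsing_inv_mul _ (isUnit_iff_ne_zero.2 hG), coordProj_mul_self, mul_one]

theorem frameProj_mul_self {M : Matrix (Fin n) (Fin n) ℝ} (hM : M.det ≠ 0) (k : ℕ) :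
    frameProj k M * frameProj k M = frameProj k M := by
  have h := frameProj_mul_frame hM k
  nth_rewrite 2 [frameProj]
  rw [← mul_assoc, ← mul_assoc, ← mul_assoc, h, frameProj]

theorem range_frameProj {M : Matrix (Fin n) (Fin n) ℝ} (hM : M.det ≠ 0) (k : ℕ) :
    LinearMap.range (frameProj k M).mulVecLin = (coordSubspace n k).map M.mulVecLin := by
  rw [← range_coordProj, ← LinearMap.range_comp, ← Matrix.mulVecLin_mul]
  refine le_antisymm ?_ (range_le_of_mul_eq_right (frameProj_mul_frame hM k))
  rw [frameProj, mul_assoc, mul_assoc, Matrix.mulVecLin_mul (M * coordProj n k)]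
  exact LinearMap.range_comp_le_range _ _

/-! ### Reading the cell coordinates of a flag off its projectors -/

theorem inv_mul_frameProj_mul (A B : Matrix (Fin n) (Fin n) ℝ) (k : ℕ) :
    A⁻¹ * frameProj k B * A⁻¹ᵀ =
      (A⁻¹ * B) * coordProj n k * (leadingBlock k (Bᵀ * B))⁻¹ * coordProj n k * (A⁻¹ * B)ᵀ := by
  simp only [frameProj, Matrix.transpose_mul, mul_assoc]

/-- Compression is multiplicative around `G⁻¹`, because `G⁻¹` fixes `1 - D` on both sides. -/
theorem leadingBlock_inv_mul_frameProj_mul {B : Matrix (Fin n) (Fin n) ℝ}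
    (hB : B.det ≠ 0) (A : Matrix (Fin n) (Fin n) ℝ) (k : ℕ) :
    leadingBlock k (A⁻¹ * frameProj k B * A⁻¹ᵀ) =
      leadingBlock k (A⁻¹ * B) * (leadingBlock k (Bᵀ * B))⁻¹ * (leadingBlock k (A⁻¹ * B))ᵀ := by
  have hG := det_leadingBlock_gram_ne_zero k hB
  rw [leadingBlock_transpose, leadingBlock_eq k (A⁻¹ * B), leadingBlock_eq k (A⁻¹ * B)ᵀ,
    compress_mul_mul_compress (coordProj_mul_self k) (compl_mul_leadingBlock_inv hG)
      (leadingBlock_inv_mul_compl hG), leadingBlock_eq, inv_mul_frameProj_mul]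

/-- Membership of a flag in the big cell of `A` can thus be tested on its projectors, without a
frame. -/
theorem det_leadingBlock_inv_mul_frameProj_ne_zero_iff {B : Matrix (Fin n) (Fin n) ℝ}
    (hB : B.det ≠ 0) (A : Matrix (Fin n) (Fin n) ℝ) (k : ℕ) :
    (leadingBlock k (A⁻¹ * frameProj k B * A⁻¹ᵀ)).det ≠ 0 ↔
      (leadingBlock k (A⁻¹ * B)).det ≠ 0 := by
  have hG := det_leadingBlock_gram_ne_zero k hB
  rw [leadingBlock_inv_mul_frameProj_mul hB, Matrix.det_mul, Matrix.det_mul, Matrix.det_transpose,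
    Matrix.det_nonsing_inv, Ring.inverse_eq_inv']
  simp [hG]

/-- The matrix `A⁻¹ P A⁻ᵀ`, with `P` the projector of the frame `B`, has the same normalized leading
columns as `A⁻¹ B`. -/
theorem inv_mul_frameProj_mul_leadingBlock_inv {A B : Matrix (Fin n) (Fin n) ℝ}
    (hB : B.det ≠ 0) {k : ℕ} (h : (leadingBlock k (A⁻¹ * B)).det ≠ 0) :
    A⁻¹ * frameProj k B * A⁻¹ᵀ * (leadingBlock k (A⁻¹ * frameProj k B * A⁻¹ᵀ))⁻¹ *
        coordProj n k = A⁻¹ * B * (leadingBlock k (A⁻¹ * B))⁻¹ * coordProj n k := by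
  have hG := det_leadingBlock_gram_ne_zero k hB
  have hN := (det_leadingBlock_inv_mul_frameProj_ne_zero_iff hB A k).2 h
  set C := A⁻¹ * B with hC
  set D := coordProj n k with hD
  set G := leadingBlock k (Bᵀ * B) with hGdef
  set L := leadingBlock k C with hL
  set N := A⁻¹ * frameProj k B * A⁻¹ᵀ with hNdef
  have hLN : leadingBlock k N = L * G⁻¹ * Lᵀ := leadingBlock_inv_mul_frameProj_mul hB A k
  have hGD : G⁻¹ * D = D * G⁻¹ := leadingBlock_inv_mul_coordProj hG
  have hDD : D * D = D := coordProj_mul_self k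
  have hCL : D * Cᵀ * D = D * Lᵀ := by
    rw [hL, leadingBlock_transpose, coordProj_mul_leadingBlock]
  have hLD : L⁻¹ * D = D * L⁻¹ := leadingBlock_inv_mul_coordProj h
  have hLu : L⁻¹ * L = 1 := Matrix.nonsing_inv_mul _ (isUnit_iff_ne_zero.2 h)
  -- The leading columns of `N` are the normalized columns of `C` times the leading block of `N`;
  -- cancelling that block gives the claim.
  have key : N * D = C * L⁻¹ * D * leadingBlock k N := by
    calc N * D = C * D * G⁻¹ * (D * Cᵀ * D) := by
          rw [hNdef, inv_mul_frameProj_mul]; simp only [← hC, ← hD, ← hGdef, mul_assoc]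
      _ = C * D * (G⁻¹ * D) * Lᵀ := by rw [hCL]; simp only [mul_assoc]
      _ = C * (D * D) * G⁻¹ * Lᵀ := by rw [hGD]; simp only [mul_assoc]
      _ = C * D * (L⁻¹ * L) * G⁻¹ * Lᵀ := by rw [hDD, hLu, mul_one]
      _ = C * (D * L⁻¹) * (L * G⁻¹ * Lᵀ) := by simp only [mul_assoc]
      _ = C * L⁻¹ * D * leadingBlock k N := by rw [← hLD, hLN]; simp only [mul_assoc]
  calc N * (leadingBlock k N)⁻¹ * D = N * D * (leadingBlock k N)⁻¹ := by
        rw [mul_assoc, leadingBlock_inv_mul_coordProj hN, ← mul_assoc]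
    _ = C * L⁻¹ * D := by
        rw [key, mul_assoc, Matrix.mul_nonsing_inv _ (isUnit_iff_ne_zero.2 hN), mul_one]

end Projector

/-! ### Immersions with a smooth left inverse -/

section Straightening

variable {E E' : Type*} [NormedAddCommGroup E] [NormedSpace ℝ E]
  [NormedAddCommGroup E'] [NormedSpace ℝ E']

/-- Inverse function theorem: a smooth map with identity derivative at a point is, near that point,
a smooth chart of the ambient space. -/
theorem exists_chart_of_hasFDerivAt_id [CompleteSpace E'] {Ψ : E' → E'} {U : Set E'}
    (hU : IsOpen U) (hΨ : ContDiffOn ℝ ∞ Ψ U) {y : E'} (hy : y ∈ U)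
    (hd : HasFDerivAt Ψ (ContinuousLinearMap.id ℝ E') y) :
    ∃ φ : OpenPartialHomeomorph E' E', φ ∈ IsManifold.maximalAtlas 𝓘(ℝ, E') ∞ E' ∧
      y ∈ φ.source ∧ ⇑φ = Ψ := by
  have hat : ContDiffAt ℝ ∞ Ψ y := hΨ.contDiffAt (hU.mem_nhds hy)
  have hinf : (∞ : WithTop ℕ∞) ≠ 0 := by simp
  have hd' : HasFDerivAt Ψ (ContinuousLinearEquiv.refl ℝ E' : E' →L[ℝ] E') y := hd
  set φ₀ := hat.toOpenPartialHomeomorph Ψ hd' hinf with hφ₀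
  -- The source is cut down to where the derivative is invertible, so that the local inverse is
  -- smooth on its whole domain and not only at the image of `y`.
  set W := U ∩ fderiv ℝ Ψ ⁻¹' Set.range ((↑) : (E' ≃L[ℝ] E') → E' →L[ℝ] E') with hW
  have hWo : IsOpen W :=
    (hΨ.continuousOn_fderiv_of_isOpen hU (by simp)).isOpen_inter_preimage hU
      ContinuousLinearEquiv.isOpen
  have hyW : y ∈ W := ⟨hy, ContinuousLinearEquiv.refl ℝ E', hd'.fderiv.symm⟩
  have hcoe : ⇑(φ₀.restr W) = Ψ := rfl
  have hsub : (φ₀.restr W).source ⊆ W := by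
    rw [φ₀.restr_source' W hWo]
    exact Set.inter_subset_right
  refine ⟨φ₀.restr W, ?_, ?_, hcoe⟩
  · refine OpenPartialHomeomorph.mem_maximalAtlas_of_contMDiffOn _ ?_ ?_
    · rw [contMDiffOn_iff_contDiffOn, hcoe]
      exact hΨ.mono fun z hz => (hsub hz).1
    · rw [contMDiffOn_iff_contDiffOn]
      intro z hz
      have hz' := hsub ((φ₀.restr W).map_target hz)
      obtain ⟨e, he⟩ := hz'.2
      refine ContDiffAt.contDiffWithinAt ?_
      have hc : ContDiffAt ℝ ∞ Ψ ((φ₀.restr W).symm z) := hΨ.contDiffAt (hU.mem_nhds hz'.1)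
      refine (φ₀.restr W).contDiffAt_symm (f₀' := e) hz ?_ hc
      rw [he]
      exact (hc.differentiableAt hinf).hasFDerivAt
  · rw [φ₀.restr_source' W hWo]
    exact ⟨hat.mem_toOpenPartialHomeomorph_source hd' hinf, hyW⟩

/-- A smooth map `f` with a smooth left inverse `g` becomes a linear inclusion in suitable charts of
the target. -/
theorem exists_chart_straightening [FiniteDimensional ℝ E] [FiniteDimensional ℝ E']
    {f : E → E'} {g : E' → E} {U : Set E'} (hU : IsOpen U)
    (hf : ContDiff ℝ ∞ f) (hg : ContDiffOn ℝ ∞ g U) (hfU : ∀ x, f x ∈ U) (hgf : ∀ x, g (f x) = x)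
    (x : E) :
    ∃ (e : (E × (Fin (Module.finrank ℝ E' - Module.finrank ℝ E) → ℝ)) ≃L[ℝ] E')
      (φ : OpenPartialHomeomorph E' E'), φ ∈ IsManifold.maximalAtlas 𝓘(ℝ, E') ∞ E' ∧
      f x ∈ φ.source ∧ ∀ u, φ (f u) = e (u, 0) := by
  have hinf : (∞ : WithTop ℕ∞) ≠ 0 := by simp
  have hfd : HasFDerivAt f (fderiv ℝ f x) x := (hf.differentiable hinf x).hasFDerivAt
  have hgd : HasFDerivAt g (fderiv ℝ g (f x)) (f x) :=
    ((hg.contDiffAt (hU.mem_nhds (hfU x))).differentiableAt hinf).hasFDerivAt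
  set B := fderiv ℝ f x
  set C := fderiv ℝ g (f x)
  have hCB : C.comp B = ContinuousLinearMap.id ℝ E := by
    have h1 := hgd.comp x hfd
    have h2 : g ∘ f = id := funext hgf
    rw [h2] at h1
    exact h1.unique (hasFDerivAt_id x)
  have hCB' : ∀ v, C (B v) = v := fun v => DFunLike.congr_fun hCB v
  have hCsurj : LinearMap.range (C : E' →ₗ[ℝ] E) = ⊤ :=
    LinearMap.range_eq_top.2 fun v => ⟨B v, hCB' v⟩
  have hdim : Module.finrank ℝ (LinearMap.ker (C : E' →ₗ[ℝ] E)) =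
      Module.finrank ℝ (Fin (Module.finrank ℝ E' - Module.finrank ℝ E) → ℝ) := by
    have := (C : E' →ₗ[ℝ] E).finrank_range_add_finrank_ker
    rw [hCsurj, finrank_top] at this
    rw [Module.finrank_fin_fun]
    omega
  let κ := LinearEquiv.ofFinrankEq _ _ hdim.symm
  -- Since `C B = 1`, the target splits as `im B ⊕ ker C`; `κ` supplies coordinates on `ker C`.
  let e₀ : (E × (Fin (Module.finrank ℝ E' - Module.finrank ℝ E) → ℝ)) ≃ₗ[ℝ] E' :=
    { toFun := fun p => B p.1 + κ p.2
      map_add' := fun p q => by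
        simp only [Prod.fst_add, Prod.snd_add, map_add, Submodule.coe_add]
        abel
      map_smul' := fun c p => by simp
      invFun := fun y => (C y, κ.symm ⟨y - B (C y), by simp [hCB']⟩)
      left_inv := fun p => by
        have hk : C (κ p.2 : E') = 0 := (κ p.2).2
        ext1
        · simp [hCB', hk]
        · rw [LinearEquiv.symm_apply_eq]
          ext1
          simp [hCB', hk]
      right_inv := fun y => by simp }
  -- The second summand is `(1 - BC)(y - f (g y))`. It vanishes on the image of `f`, so `Ψ (f u) = B
  -- u` for every `u`. The derivative at `f x` is `BC + (1 - BC)²`, which is the identity because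
  -- `BC` is idempotent.
  set Ψ : E' → E' := fun y => B (g y) + (y - f (g y) - B (C (y - f (g y)))) with hΨdef
  have hΨ : ContDiffOn ℝ ∞ Ψ U := by
    have h1 : ContDiffOn ℝ ∞ (fun y => y - f (g y)) U :=
      contDiffOn_id.sub (hf.comp_contDiffOn hg)
    exact (B.contDiff.comp_contDiffOn hg).add
      (h1.sub (B.contDiff.comp_contDiffOn (C.contDiff.comp_contDiffOn h1)))
  have hΨd : HasFDerivAt Ψ (ContinuousLinearMap.id ℝ E') (f x) := by
    have hfd' : HasFDerivAt f B (g (f x)) := by rwa [hgf]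
    have h1 : HasFDerivAt (fun y => y - f (g y)) (ContinuousLinearMap.id ℝ E' - B.comp C) (f x) :=
      (hasFDerivAt_id _).sub (hfd'.comp (f x) hgd)
    have h2 := (B.hasFDerivAt.comp (f x) hgd).add
      (h1.sub (B.hasFDerivAt.comp (f x) (C.hasFDerivAt.comp (f x) h1)))
    refine h2.congr_fderiv ?_
    ext v
    simp [hCB']
  obtain ⟨φ, hφ, hxφ, hcoe⟩ := exists_chart_of_hasFDerivAt_id hU hΨ (hfU x) hΨd
  refine ⟨e₀.toContinuousLinearEquiv, φ, hφ, hxφ, fun u => ?_⟩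
  rw [hcoe]
  simp [hΨdef, hgf, e₀]

end Straightening

/-! ### Transport of a manifold structure along a homeomorphism -/

section Transport

variable {E H M N : Type*} [NormedAddCommGroup E] [NormedSpace ℝ E] [TopologicalSpace H]
  [TopologicalSpace M] [TopologicalSpace N] [ChartedSpace H M]

/-- The charted space structure transported along a homeomorphism. -/
@[reducible]
def Homeomorph.transportChartedSpace (h : M ≃ₜ N) : ChartedSpace H N where
  atlas := (fun e => h.symm.toOpenPartialHomeomorph.trans e) '' atlas H M
  chartAt y := h.symm.toOpenPartialHomeomorph.trans (chartAt H (h.symm y))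
  mem_chart_source y := by simp
  chart_mem_atlas y := ⟨_, chart_mem_atlas H _, rfl⟩

theorem Homeomorph.chartAt_transport (h : M ≃ₜ N) (y : N) :
    letI := h.transportChartedSpace (H := H)
    chartAt H y = h.symm.toOpenPartialHomeomorph.trans (chartAt H (h.symm y)) :=
  rfl

theorem Homeomorph.isManifold_transport (I : ModelWithCorners ℝ E H) (h : M ≃ₜ N)
    [IsManifold I ∞ M] :
    letI := h.transportChartedSpace (H := H)
    IsManifold I ∞ N := by
  let _ := h.transportChartedSpace (H := H)
  have : HasGroupoid N (contDiffGroupoid ∞ I) := by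
    refine ⟨?_⟩
    rintro _ _ ⟨e, he, rfl⟩ ⟨e', he', rfl⟩
    -- The homeomorphism cancels, so the transition maps are those of `M`.
    have heq : (h.symm.toOpenPartialHomeomorph.trans e).symm.trans
        (h.symm.toOpenPartialHomeomorph.trans e') = e.symm.trans e' := by
      refine OpenPartialHomeomorph.ext _ _ (fun x => ?_) (fun x => ?_) ?_
      · simp
      · simp
      · ext x; simp
    simp only [heq]
    exact HasGroupoid.compatible he he'
  exact IsManifold.mk' I ∞ N

theorem Homeomorph.contMDiff_transport (I : ModelWithCorners ℝ E H) (h : M ≃ₜ N)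
    [IsManifold I ∞ M] :
    letI := h.transportChartedSpace (H := H)
    ContMDiff I I ∞ h := by
  let _ := h.transportChartedSpace (H := H)
  intro x
  rw [contMDiffAt_iff]
  refine ⟨h.continuous.continuousAt, ?_⟩
  -- In corresponding charts the homeomorphism reads as the identity.
  refine contDiffWithinAt_id.congr_of_eventuallyEq_of_mem ?_ (by simp)
  filter_upwards [extChartAt_target_mem_nhdsWithin x] with u hu
  have hu' := (extChartAt I x).right_inv hu
  have hc := h.chartAt_transport (H := H) (h x)
  rw [h.symm_apply_apply] at hc
  simpa [extChartAt, hc] using hu'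

theorem Homeomorph.contMDiff_symm_transport (I : ModelWithCorners ℝ E H) (h : M ≃ₜ N)
    [IsManifold I ∞ M] :
    letI := h.transportChartedSpace (H := H)
    ContMDiff I I ∞ h.symm := by
  let _ := h.transportChartedSpace (H := H)
  intro y
  rw [contMDiffAt_iff]
  refine ⟨h.symm.continuous.continuousAt, ?_⟩
  refine contDiffWithinAt_id.congr_of_eventuallyEq_of_mem ?_ (by simp)
  filter_upwards [extChartAt_target_mem_nhdsWithin y] with u hu
  have hu' := (extChartAt I y).right_inv hu
  have hc := h.chartAt_transport (H := H) y
  rw [extChartAt, hc] at hu'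
  simpa [extChartAt, hc] using hu'

/-- A homeomorphism as a diffeomorphism onto the transported structure. -/
def Homeomorph.diffeomorphTransport (I : ModelWithCorners ℝ E H) (h : M ≃ₜ N) [IsManifold I ∞ M] :
    letI := h.transportChartedSpace (H := H)
    Diffeomorph I I M N ∞ :=
  letI := h.transportChartedSpace (H := H)
  { toEquiv := h.toEquiv
    contMDiff_toFun := h.contMDiff_transport I
    contMDiff_invFun := h.contMDiff_symm_transport I }

end Transport

/-! ### Flags and tuples of projectors -/

section Flags

variable {n d : ℕ} {ns : Fin d → ℕ}

theorem range_frameProj_of_isFrame {B : Matrix (Fin n) (Fin n) ℝ} {F : FlagManifold n ns}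
    (hB : IsFrame B F) (i : Fin d) :
    LinearMap.range (frameProj (ns i) B).mulVecLin = F.V i := by
  rw [range_frameProj hB.1, hB.2]

/-- The block diagonal matrix of the orthogonal projectors of the subspaces spanned by the leading
columns of `B`. -/
noncomputable def frameProjectors (ns : Fin d → ℕ) (B : Matrix (Fin n) (Fin n) ℝ) :
    Matrix (Fin n × Fin d) (Fin n × Fin d) ℝ :=
  Matrix.blockDiagonal fun i => frameProj (ns i) B

theorem frameProjectors_mem {B : Matrix (Fin n) (Fin n) ℝ} {F : FlagManifold n ns}
    (hB : IsFrame B F) : frameProjectors ns B ∈ projectionFlags n ns := by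
  refine ⟨_, rfl, fun i => ⟨frameProj_mul_self hB.1 _, frameProj_transpose _ _, ?_⟩,
    fun i j hij => ?_⟩
  · rw [trace_eq_finrank_range (frameProj_mul_self hB.1 _), range_frameProj_of_isFrame hB,
      F.finrank_eq]
  · refine mul_eq_right_of_range_le (frameProj_mul_self hB.1 _) ?_
    rw [range_frameProj_of_isFrame hB, range_frameProj_of_isFrame hB]
    exact F.strictMono.monotone hij.le

theorem blockDiag_mem {M : Matrix (Fin n × Fin d) (Fin n × Fin d) ℝ}
    (hM : M ∈ projectionFlags n ns) :
    M = Matrix.blockDiagonal (Matrix.blockDiag M) ∧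
    (∀ i, Matrix.blockDiag M i * Matrix.blockDiag M i = Matrix.blockDiag M i ∧
      (Matrix.blockDiag M i)ᵀ = Matrix.blockDiag M i ∧
      (Matrix.blockDiag M i).trace = (ns i : ℝ)) ∧
    ∀ i j, i < j → Matrix.blockDiag M j * Matrix.blockDiag M i = Matrix.blockDiag M i := by
  obtain ⟨P, rfl, h1, h2⟩ := hM
  rw [Matrix.blockDiag_blockDiagonal]
  exact ⟨rfl, h1, h2⟩

/-- An element of `projectionFlags` is determined by the ranges of its blocks. -/
theorem projectionFlags_ext {M N : Matrix (Fin n × Fin d) (Fin n × Fin d) ℝ}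
    (hM : M ∈ projectionFlags n ns) (hN : N ∈ projectionFlags n ns)
    (h : ∀ i, LinearMap.range (Matrix.blockDiag M i).mulVecLin =
      LinearMap.range (Matrix.blockDiag N i).mulVecLin) : M = N := by
  obtain ⟨hM0, hM1, -⟩ := blockDiag_mem hM
  obtain ⟨hN0, hN1, -⟩ := blockDiag_mem hN
  rw [hM0, hN0]
  congr 1
  funext i
  exact projector_ext (hM1 i).1 (hM1 i).2.1 (hN1 i).1 (hN1 i).2.1 (h i)

theorem range_blockDiag_frameProjectors {B : Matrix (Fin n) (Fin n) ℝ} {F : FlagManifold n ns}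
    (hB : IsFrame B F) (i : Fin d) :
    LinearMap.range (Matrix.blockDiag (frameProjectors ns B) i).mulVecLin = F.V i := by
  rw [frameProjectors, Matrix.blockDiag_blockDiagonal, range_frameProj_of_isFrame hB]

/-- The flag of the ranges of the blocks. -/
noncomputable def rangeFlag (hmono : StrictMono ns) (P : projectionFlags n ns) :
    FlagManifold n ns where
  V i := LinearMap.range (Matrix.blockDiag P.1 i).mulVecLin
  strictMono := by
    obtain ⟨-, h1, h2⟩ := blockDiag_mem P.2
    intro i j hij
    -- Strictness comes from the traces: equal ranges would force `ns i = ns j`.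
    refine lt_of_le_of_ne (range_le_of_mul_eq_right (h2 i j hij)) fun he => ?_
    have hi := trace_eq_finrank_range (h1 i).1
    have hj := trace_eq_finrank_range (h1 j).1
    rw [show LinearMap.range _ = LinearMap.range _ from he, ← hj, (h1 i).2.2, (h1 j).2.2] at hi
    exact (hmono hij).ne (by exact_mod_cast hi)
  finrank_eq i := by
    obtain ⟨-, h1, -⟩ := blockDiag_mem P.2
    have hi := trace_eq_finrank_range (h1 i).1
    rw [(h1 i).2.2] at hi
    exact_mod_cast hi.symm

/-- Flags correspond to tuples of projectors. -/
noncomputable def flagEquiv (hmono : StrictMono ns) :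
    FlagManifold n ns ≃ projectionFlags n ns where
  toFun F := ⟨_, frameProjectors_mem (exists_isFrame F).choose_spec⟩
  invFun := rangeFlag hmono
  left_inv F := FlagManifold.ext
    (funext fun i => range_blockDiag_frameProjectors (exists_isFrame F).choose_spec i)
  right_inv P := Subtype.ext <| projectionFlags_ext (frameProjectors_mem
    (exists_isFrame (rangeFlag hmono P)).choose_spec) P.2
      fun i => range_blockDiag_frameProjectors (exists_isFrame (rangeFlag hmono P)).choose_spec i

theorem range_blockDiag_flagEquiv (hmono : StrictMono ns) (F : FlagManifold n ns) (i : Fin d) :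
    LinearMap.range (Matrix.blockDiag (flagEquiv hmono F).1 i).mulVecLin = F.V i :=
  range_blockDiag_frameProjectors (exists_isFrame F).choose_spec i

/-- `flagEquiv` is built from a chosen frame, but projectors depend only on the subspaces. Any frame
may therefore be used, in particular the moving frame `A (1 + x)` of a cell. -/
theorem flagEquiv_eq_frameProjectors (hmono : StrictMono ns) {F : FlagManifold n ns}
    {B : Matrix (Fin n) (Fin n) ℝ} (hB : IsFrame B F) :
    (flagEquiv hmono F).1 = frameProjectors ns B :=
  projectionFlags_ext (flagEquiv hmono F).2 (frameProjectors_mem hB) fun i => by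
    rw [range_blockDiag_flagEquiv, range_blockDiag_frameProjectors hB]

theorem isFrame_cellFlag {A : Matrix (Fin n) (Fin n) ℝ} {F : FlagManifold n ns}
    (hA : IsFrame A F) (x : CellModel n ns) : IsFrame (A * lowerUnipotent x) (cellFlag hA x) :=
  ⟨det_mul_lowerUnipotent hA.1 x, fun _ => rfl⟩

/-! ### Cell coordinates of a tuple of projectors -/

/-- The block of columns that contains a given cell. -/
theorem CellIndex.exists_block (p : CellIndex n ns) : ∃ j, ns j = blockEnd ns p.1.2 :=
  (blockEnd_spec p.2.choose_spec.1).2.1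

/-- The matrix `A⁻¹ P A⁻ᵀ`, where `P` is the `j`-th diagonal block of `y`. -/
noncomputable def blockGram (A : Matrix (Fin n) (Fin n) ℝ)
    (y : Fin n × Fin d → Fin n × Fin d → ℝ) (j : Fin d) : Matrix (Fin n) (Fin n) ℝ :=
  A⁻¹ * Matrix.of (fun a b => y (a, j) (b, j)) * A⁻¹ᵀ

/-- The tuples of matrices on which the cell coordinates are defined. -/
def cellReadDomain (ns : Fin d → ℕ) (A : Matrix (Fin n) (Fin n) ℝ) :
    Set (Fin n × Fin d → Fin n × Fin d → ℝ) :=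
  {y | ∀ i, (leadingBlock (ns i) (blockGram A y i)).det ≠ 0}

/-- The cell coordinates, relative to `A`, of a tuple of projectors. -/
noncomputable def cellRead (ns : Fin d → ℕ) (A : Matrix (Fin n) (Fin n) ℝ)
    (y : Fin n × Fin d → Fin n × Fin d → ℝ) : CellModel n ns :=
  WithLp.toLp 2 fun p => (blockGram A y p.exists_block.choose *
    (leadingBlock (ns p.exists_block.choose) (blockGram A y p.exists_block.choose))⁻¹) p.1.1 p.1.2

theorem contDiff_blockGram_entry (A : Matrix (Fin n) (Fin n) ℝ) (j : Fin d) (a b : Fin n) :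
    ContDiff ℝ ∞ fun y : Fin n × Fin d → Fin n × Fin d → ℝ => blockGram A y j a b :=
  contDiff_mul_entry
    (contDiff_mul_entry (M := fun _ => A⁻¹) (fun _ _ => contDiff_const)
      (fun _ _ => contDiff_apply_apply ℝ ℝ _ _))
    (N := fun _ => A⁻¹ᵀ) (fun _ _ => contDiff_const) a b

theorem isOpen_cellReadDomain (A : Matrix (Fin n) (Fin n) ℝ) : IsOpen (cellReadDomain ns A) := by
  rw [cellReadDomain, Set.ofPred_forall]
  refine isOpen_iInter_of_finite fun i => ?_
  exact isOpen_ne_fun (contDiff_det_entry (contDiff_leadingBlock_entry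
    (contDiff_blockGram_entry A i) _)).continuous continuous_const

theorem contDiffOn_cellRead (A : Matrix (Fin n) (Fin n) ℝ) :
    ContDiffOn ℝ ∞ (cellRead ns A) (cellReadDomain ns A) := by
  rw [contDiffOn_euclidean]
  intro p
  simp only [cellRead, Matrix.mul_apply]
  refine ContDiffOn.sum fun c _ => (contDiff_blockGram_entry A _ _ c).contDiffOn.mul ?_
  exact contDiffOn_inv_entry (contDiff_leadingBlock_entry (contDiff_blockGram_entry A _) _)
    (s := cellReadDomain ns A) (fun y hy => hy _) _ _

/-- The entries of `frameProjectors`, as a vector of the ambient space. -/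
noncomputable def frameVector (ns : Fin d → ℕ) (B : Matrix (Fin n) (Fin n) ℝ) :
    Fin n × Fin d → Fin n × Fin d → ℝ :=
  fun p q => frameProjectors ns B p q

theorem blockGram_frameVector (A B : Matrix (Fin n) (Fin n) ℝ) (j : Fin d) :
    blockGram A (frameVector ns B) j = A⁻¹ * frameProj (ns j) B * A⁻¹ᵀ := by
  have : Matrix.of (fun a b => frameVector ns B (a, j) (b, j)) = frameProj (ns j) B := by
    ext a b
    simp [frameVector, frameProjectors]
  rw [blockGram, this]

theorem frameVector_mem_cellReadDomain_iff {A B : Matrix (Fin n) (Fin n) ℝ} (hB : B.det ≠ 0) :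
    frameVector ns B ∈ cellReadDomain ns A ↔
      ∀ i, (leadingBlock (ns i) (A⁻¹ * B)).det ≠ 0 :=
  forall_congr' fun i => by
    rw [blockGram_frameVector, det_leadingBlock_inv_mul_frameProj_ne_zero_iff hB]

theorem cellRead_frameVector {A B : Matrix (Fin n) (Fin n) ℝ} (hB : B.det ≠ 0)
    (h : ∀ i, (leadingBlock (ns i) (A⁻¹ * B)).det ≠ 0) :
    cellRead ns A (frameVector ns B) = cellCoord ns (A⁻¹ * B) := by
  ext p
  have hj := p.exists_block.choose_spec
  have hlt : (p.1.2 : ℕ) < blockEnd ns p.1.2 := (blockEnd_spec p.2.choose_spec.1).1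
  -- The column of the cell lies before the end of its block, so multiplying by the coordinate
  -- projection leaves the entry unchanged.
  have entry : ∀ M : Matrix (Fin n) (Fin n) ℝ,
      (M * coordProj n (ns p.exists_block.choose)) p.1.1 p.1.2 = M p.1.1 p.1.2 := fun M => by
    rw [hj]
    simp [coordProj, Matrix.mul_diagonal, hlt]
  have key := congrFun (congrFun
    (inv_mul_frameProj_mul_leadingBlock_inv hB (h p.exists_block.choose)) p.1.1) p.1.2
  rw [entry, entry] at key
  simp only [cellRead, cellCoord, blockGram_frameVector]
  rw [key, hj]

theorem frame_inv_mul_cellFrame (A : Matrix (Fin n) (Fin n) ℝ) (hA : A.det ≠ 0)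
    (x : CellModel n ns) : A⁻¹ * (A * lowerUnipotent x) = lowerUnipotent x := by
  rw [← mul_assoc, Matrix.nonsing_inv_mul _ (isUnit_iff_ne_zero.2 hA), one_mul]

theorem frameVector_cell_mem {A : Matrix (Fin n) (Fin n) ℝ} (hA : A.det ≠ 0)
    (x : CellModel n ns) : frameVector ns (A * lowerUnipotent x) ∈ cellReadDomain ns A := by
  rw [frameVector_mem_cellReadDomain_iff (det_mul_lowerUnipotent hA x),
    frame_inv_mul_cellFrame A hA]
  intro i
  rw [det_leadingBlock_lowerUnipotent]
  exact one_ne_zero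

theorem cellRead_frameVector_cell {A : Matrix (Fin n) (Fin n) ℝ} (hA : A.det ≠ 0)
    (x : CellModel n ns) : cellRead ns A (frameVector ns (A * lowerUnipotent x)) = x := by
  have hB := det_mul_lowerUnipotent hA x
  rw [cellRead_frameVector hB ((frameVector_mem_cellReadDomain_iff hB).1
    (frameVector_cell_mem hA x)), frame_inv_mul_cellFrame A hA]
  refine (eq_cellCoord ?_ fun _ => rfl).symm
  rw [det_lowerUnipotent]
  exact one_ne_zero

/-- A flag whose projectors lie in the domain of the cell coordinates lies in the cell. -/
theorem cellFlag_cellRead {A B : Matrix (Fin n) (Fin n) ℝ} {F G : FlagManifold n ns}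
    (hA : IsFrame A F) (hB : IsFrame B G) (h : frameVector ns B ∈ cellReadDomain ns A) :
    cellFlag hA (cellRead ns A (frameVector ns B)) = G := by
  have h' := (frameVector_mem_cellReadDomain_iff hB.1).1 h
  have hd : (A⁻¹ * B).det ≠ 0 := by
    rw [Matrix.det_mul, Matrix.det_nonsing_inv, Ring.inverse_eq_inv']
    exact mul_ne_zero (inv_ne_zero hA.1) hB.1
  rw [cellRead_frameVector hB.1 h']
  refine FlagManifold.ext (funext fun i => ?_)
  rw [hB.2 i]
  exact (map_mul_eq_iff hA.1 _ _ _).2 (map_lowerUnipotent_cellCoord hd h' i)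

/-- The entries are rational in `x`, and the denominators are Gram determinants that vanish nowhere
on the model space. -/
theorem contDiff_frameVector_cell {A : Matrix (Fin n) (Fin n) ℝ} (hA : A.det ≠ 0) :
    ContDiff ℝ ∞ fun x : CellModel n ns => frameVector ns (A * lowerUnipotent x) := by
  have hM : ∀ a b, ContDiff ℝ ∞ fun x : CellModel n ns => (A * lowerUnipotent x) a b :=
    contDiff_mul_entry (M := fun _ => A) (fun _ _ => contDiff_const) contDiff_lowerUnipotent
  have hMt : ∀ a b, ContDiff ℝ ∞ fun x : CellModel n ns => (A * lowerUnipotent x)ᵀ a b :=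
    fun a b => hM b a
  have hG : ∀ (k : ℕ) (a b : Fin n), ContDiff ℝ ∞ fun x : CellModel n ns =>
      (leadingBlock k ((A * lowerUnipotent x)ᵀ * (A * lowerUnipotent x)))⁻¹ a b := fun k a b =>
    contDiffOn_univ.1 (contDiffOn_inv_entry
      (contDiff_leadingBlock_entry (contDiff_mul_entry hMt hM) k)
      (fun x _ => det_leadingBlock_gram_ne_zero k (det_mul_lowerUnipotent hA x)) a b)
  have hP : ∀ (k : ℕ) (a b : Fin n), ContDiff ℝ ∞ fun x : CellModel n ns =>
      frameProj k (A * lowerUnipotent x) a b := fun k =>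
    contDiff_mul_entry (contDiff_mul_entry (contDiff_mul_entry
      (contDiff_mul_entry hM (N := fun _ => coordProj n k) fun _ _ => contDiff_const) (hG k))
      (N := fun _ => coordProj n k) fun _ _ => contDiff_const) hMt
  refine contDiff_pi.2 fun p => contDiff_pi.2 fun q => ?_
  by_cases hpq : p.2 = q.2
  · simpa [frameVector, frameProjectors, Matrix.blockDiagonal_apply, hpq] using hP _ _ _
  · simpa [frameVector, frameProjectors, Matrix.blockDiagonal_apply, hpq] using contDiff_const

/-! ### The homeomorphism -/

/-- The inclusion of the tuples of projectors in the space of matrices. -/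
def projectionVector (P : projectionFlags n ns) : Fin n × Fin d → Fin n × Fin d → ℝ :=
  fun p q => P.1 p q

theorem isEmbedding_projectionVector :
    Topology.IsEmbedding (projectionVector (n := n) (ns := ns)) :=
  Topology.IsEmbedding.subtypeVal

theorem projectionVector_flagEquiv (hmono : StrictMono ns) {F : FlagManifold n ns}
    {B : Matrix (Fin n) (Fin n) ℝ} (hB : IsFrame B F) :
    projectionVector (flagEquiv hmono F) = frameVector ns B := by
  funext p q
  rw [projectionVector, flagEquiv_eq_frameProjectors hmono hB, frameVector]

theorem coe_chartAt_symm_flag (F : FlagManifold n ns) :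
    ⇑(chartAt (CellModel n ns) F).symm = cellFlag (exists_isFrame F).choose_spec :=
  rfl

theorem projectionVector_cellFlag (hmono : StrictMono ns) {A : Matrix (Fin n) (Fin n) ℝ}
    {F : FlagManifold n ns} (hA : IsFrame A F) (x : CellModel n ns) :
    projectionVector (flagEquiv hmono (cellFlag hA x)) =
      frameVector ns (A * lowerUnipotent x) :=
  projectionVector_flagEquiv hmono (isFrame_cellFlag hA x)

theorem flagEquiv_mem_cellReadDomain (hmono : StrictMono ns) {A : Matrix (Fin n) (Fin n) ℝ}
    {F : FlagManifold n ns} (hA : IsFrame A F) :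
    projectionVector (flagEquiv hmono F) ∈ cellReadDomain ns A := by
  obtain ⟨x, hx⟩ := mem_cellChart_source hA
  rw [← hx, projectionVector_cellFlag]
  exact frameVector_cell_mem hA.1 x

/-- Near `F` the map is the chart followed by the smooth parametrization of projectors. -/
theorem continuous_flagEquiv (hmono : StrictMono ns) :
    Continuous (flagEquiv (n := n) hmono) := by
  rw [isEmbedding_projectionVector.continuous_iff, continuous_iff_continuousAt]
  intro F
  set hA := (exists_isFrame F).choose_spec
  set e := chartAt (CellModel n ns) F with he
  have hF : F ∈ e.source := mem_chart_source _ F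
  have hev : projectionVector ∘ flagEquiv hmono =ᶠ[nhds F]
      (fun x => frameVector ns ((exists_isFrame F).choose * lowerUnipotent x)) ∘ e := by
    filter_upwards [e.open_source.mem_nhds hF] with G hG
    have h1 := e.left_inv hG
    rw [he, coe_chartAt_symm_flag] at h1
    rw [Function.comp_apply, Function.comp_apply, ← projectionVector_cellFlag hmono hA, h1]
  refine ContinuousAt.congr ?_ hev.symm
  exact (contDiff_frameVector_cell hA.1).continuous.continuousAt.comp (e.continuousAt hF)

/-- The coordinates are read off the projectors by `cellRead`, on an open set that contains `P`, and
are then fed to the inverse chart. This uses that every tuple in that open set comes from a flag in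
the cell. -/
theorem continuous_flagEquiv_symm (hmono : StrictMono ns) :
    Continuous (flagEquiv (n := n) hmono).symm := by
  rw [continuous_iff_continuousAt]
  intro P
  set F := (flagEquiv hmono).symm P with hF
  set hA := (exists_isFrame F).choose_spec
  set e := chartAt (CellModel n ns) F with he
  have hP : projectionVector P ∈ cellReadDomain ns (exists_isFrame F).choose := by
    have := flagEquiv_mem_cellReadDomain hmono hA
    rwa [hF, Equiv.apply_symm_apply] at this
  have hnhds := (isOpen_cellReadDomain (ns := ns) (exists_isFrame F).choose).mem_nhds hP
  have hev : (flagEquiv hmono).symm =ᶠ[nhds P]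
      fun Q => e.symm (cellRead ns (exists_isFrame F).choose (projectionVector Q)) := by
    filter_upwards [isEmbedding_projectionVector.continuous.continuousAt hnhds] with Q hQ
    obtain ⟨B, hB⟩ := exists_isFrame ((flagEquiv hmono).symm Q)
    have hv := projectionVector_flagEquiv hmono hB
    rw [Equiv.apply_symm_apply] at hv
    change projectionVector Q ∈ cellReadDomain ns _ at hQ
    rw [hv] at hQ ⊢
    rw [he, coe_chartAt_symm_flag]
    exact (cellFlag_cellRead hA hB hQ).symm
  refine ContinuousAt.congr ?_ hev.symm
  have h1 : ContinuousAt (fun Q => cellRead ns (exists_isFrame F).choose (projectionVector Q)) P :=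
    ((contDiffOn_cellRead _).continuousOn.continuousAt hnhds).comp
      isEmbedding_projectionVector.continuous.continuousAt
  -- The target of a cell chart is the whole model space.
  exact ContinuousAt.comp (g := e.symm) (e.symm.continuousAt (Set.mem_univ _)) h1

/-- The homeomorphism between flags and tuples of projectors. -/
noncomputable def flagHomeomorph (hmono : StrictMono ns) :
    FlagManifold n ns ≃ₜ projectionFlags n ns where
  toEquiv := flagEquiv hmono
  continuous_toFun := continuous_flagEquiv hmono
  continuous_invFun := continuous_flagEquiv_symm hmono

/-- In a transported chart the inclusion reads as `x ↦ frameVector ns (A (1 + x))`. Its smooth left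
inverse `cellRead` makes it an immersion, with complement of dimension equal to the codimension. -/
theorem isSmoothEmbedding_projectionVector (hmono : StrictMono ns) :
    let _ := (flagHomeomorph (n := n) hmono).transportChartedSpace (H := CellModel n ns)
    Manifold.IsSmoothEmbedding 𝓘(ℝ, CellModel n ns) 𝓘(ℝ, Fin n × Fin d → Fin n × Fin d → ℝ) ∞
      (projectionVector (n := n) (ns := ns)) := by
  let _ := (flagHomeomorph (n := n) hmono).transportChartedSpace (H := CellModel n ns)
  have _ := (flagHomeomorph (n := n) hmono).isManifold_transport 𝓘(ℝ, CellModel n ns)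
  refine ⟨Manifold.IsImmersionOfComplement.isImmersion
    (F := Fin (Module.finrank ℝ (Fin n × Fin d → Fin n × Fin d → ℝ) -
      Module.finrank ℝ (CellModel n ns)) → ℝ) fun P => ?_, isEmbedding_projectionVector⟩
  set F := (flagEquiv hmono).symm P with hF
  set hA := (exists_isFrame F).choose_spec
  obtain ⟨x, hx⟩ := mem_cellChart_source hA
  have hPx : projectionVector P = frameVector ns ((exists_isFrame F).choose * lowerUnipotent x) := by
    rw [← projectionVector_cellFlag hmono hA, hx, hF, Equiv.apply_symm_apply]
  obtain ⟨e, φ, hφ, hxφ, heq⟩ := exists_chart_straightening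
    (isOpen_cellReadDomain (ns := ns) (exists_isFrame F).choose)
    (contDiff_frameVector_cell hA.1) (contDiffOn_cellRead _) (frameVector_cell_mem hA.1)
    (cellRead_frameVector_cell hA.1) x
  refine Manifold.IsImmersionAtOfComplement.mk_of_continuousAt
    isEmbedding_projectionVector.continuous.continuousAt e (chartAt _ P) φ
    (mem_chart_source _ P) (by rwa [hPx]) (IsManifold.chart_mem_maximalAtlas P) hφ ?_
  -- The inverse of the transported chart is `flagEquiv` after `cellFlag`, so the straightening
  -- identity is exactly the required local form.
  intro u _
  have hu := heq u
  rw [← projectionVector_cellFlag hmono hA] at hu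
  exact hu

end Flags

/-- The set of block-diagonal matrices of projectors is an embedded submanifold of the space of
`nd × nd` matrices, and the flag manifold is diffeomorphic to it through
`(V₁, …, V_d) ↦ diag(V₁V₁ᵀ, …, V_dV_dᵀ)`, with inverse `P ↦ (im P₁, …, im P_d)`. -/
theorem mainTheorem10 (n d : ℕ) (ns : Fin d → ℕ) (hpos : ∀ i, 0 < ns i) (hmono : StrictMono ns)
    (hlt : ∀ i, ns i < n) :
    (∃ _ : ChartedSpace (CellModel n ns) (projectionFlags n ns),
      IsManifold 𝓘(ℝ, CellModel n ns) ∞ (projectionFlags n ns) ∧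
      Manifold.IsSmoothEmbedding 𝓘(ℝ, CellModel n ns)
        𝓘(ℝ, Fin n × Fin d → Fin n × Fin d → ℝ) ∞
        (fun (P : projectionFlags n ns) (p q : Fin n × Fin d) => P.1 p q) ∧
      ∃ Φ : Diffeomorph 𝓘(ℝ, CellModel n ns) 𝓘(ℝ, CellModel n ns)
          (FlagManifold n ns) (projectionFlags n ns) ∞,
        (∀ (F : FlagManifold n ns) (A : ∀ i, Matrix (Fin n) (Fin (ns i)) ℝ),
          (∀ i, (A i)ᵀ * A i = 1 ∧ LinearMap.range (A i).mulVecLin = F.V i) →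
          (Φ F : Matrix (Fin n × Fin d) (Fin n × Fin d) ℝ) =
            Matrix.blockDiagonal fun i => A i * (A i)ᵀ) ∧
        ∀ (P : projectionFlags n ns) (i : Fin d),
          (Φ.symm P).V i = LinearMap.range (Matrix.blockDiag P.1 i).mulVecLin) ∧
    ∀ F : FlagManifold n ns, ∃! P : Matrix (Fin n × Fin d) (Fin n × Fin d) ℝ,
      P ∈ projectionFlags n ns ∧
        ∀ i, LinearMap.range (Matrix.blockDiag P i).mulVecLin = F.V i := by
  refine ⟨⟨(flagHomeomorph hmono).transportChartedSpace (H := CellModel n ns),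
    (flagHomeomorph hmono).isManifold_transport 𝓘(ℝ, CellModel n ns),
    isSmoothEmbedding_projectionVector hmono,
    (flagHomeomorph hmono).diffeomorphTransport 𝓘(ℝ, CellModel n ns), fun F A hA => ?_,
    fun P i => rfl⟩, fun F => ⟨(flagEquiv hmono F).1, ⟨(flagEquiv hmono F).2,
      range_blockDiag_flagEquiv hmono F⟩, fun Q hQ => projectionFlags_ext hQ.1
        (flagEquiv hmono F).2 fun i => by rw [hQ.2 i, range_blockDiag_flagEquiv]⟩⟩
  change (flagEquiv hmono F).1 = _
  obtain ⟨h0, h1, -⟩ := blockDiag_mem (flagEquiv hmono F).2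
  rw [h0]
  congr 1
  funext i
  -- Orthonormality of the columns makes `A i * (A i)ᵀ` a symmetric idempotent with range `F.V i`,
  -- and a projector is determined by its range.
  have hAA : A i * (A i)ᵀ * A i = A i := by rw [Matrix.mul_assoc, (hA i).1, Matrix.mul_one]
  refine projector_ext (h1 i).1 (h1 i).2.1 ?_ ?_ ?_
  · rw [← Matrix.mul_assoc, hAA]
  · rw [Matrix.transpose_mul, Matrix.transpose_transpose]
  · rw [range_blockDiag_flagEquiv, ← (hA i).2]
    refine le_antisymm (range_le_of_mul_eq_right hAA) ?_
    rw [Matrix.mulVecLin_mul]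
    exact LinearMap.range_comp_le_range _ _
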